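/- **Setting.** Let $\Omega_u=[a,b]\times[y_0,y_1]$ carry a uniform grid with $N_x+1$ by $N_y+1$ points, $h_u=(b-a)/N_x$. Let $\Omega_v$ be a polygonal domain with a conforming triangulation $\mathcal K_h$ such that $\Omega_u\cap\Omega_v=\Gamma:=[a,b]\times\{y_0\}$ and $\Gamma$ is a union of edges. Let $h_K$ be the diameter and $r_K$ the inradius of $K$, $h_v=\min_K h_K$, and let $V=\{v: v|_K\in\mathcal P_q(K)^2\ \forall K\in\mathcal K_h\}$. The Lamé parameters $\mu_u,\lambda_u,\mu_v,\lambda_v$ are positive and the densities $\rho_u,\rho_v$ non-negative; $\sigma$ and $\varepsilon$ denote stress and strain, $\chi_1=2\mu_v+\lambda_v$, $\chi_2=2\mu_u+\lambda_u$. *SBP operators.* With $B=\mathrm{diag}(-1,0,\dots,0,1)$, let $H_x,H_y$ be symmetric positive definite, $HD+(HD)^T=B$ in each direction, $D_{xx}=H_x^{-1}(-D_x^TH_xD_x-R_x+BS_x)$ (compatible), and $D_{yy}=H_y^{-1}(-D_y^TH_yD_y-R_y+BD_y)$ (fully compatible), with $R_x,R_y$ symmetric positive semidefinite. Calligraphic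 letters denote the tensor-product extensions to two components and two dimensions, $\mathcal H=\mathcal H_x\mathcal H_y$, and $\mathcal B_\Gamma,\mathcal B_{N}$ restrict to the southern and northern boundary. Put $$L_1=\begin{pmatrix}\chi_2&0\\0&\mu_u\end{pmatrix},\quad L_2=\begin{pmatrix}0&\lambda_u\\\mu_u&0\end{pmatrix},\quad L_3=\begin{pmatrix}\mu_u&0\\0&\chi_2\end{pmatrix}$$ acting on components, $\mathcal T_x=L_1\mathcal S_x+L_2\mathcal D_y$ ($S_x=D_x$ in the fully compatible case), $\mathcal T_y=L_3\mathcal D_y+L_2^T\mathcal D_x$, $\mathcal T_u=-\mathcal B_\Gamma\mathcal T_y$. *Projections.* Let $M_\Gamma$ be the mass matrix, in a nodal basis, of the discontinuous piecewise polynomials of degree $\le q$ on the edges along $\Gamma$. Let $(P^g_{u2v},P^b_{v2u})$ and $(P^b_{u2v},P^g_{v2u})$ be pairs of matrices between the grid on $\Gamma$ and these nodal coefficients that are norm compatible, i.e. $M_\Gamma P_{u2v}=(H_xP_{v2u})^T$ for each pair; the same symbols denote their full-size extensions. Let $v_\Gamma$, $T_vv$ be the nodal values along $\Gamma$ of $v$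 and of $\sigma(v)(0,1)^T$, let $u_\Gamma=\mathcal B_\Gamma u$, and identify nodal coefficients with piecewise polynomials on $\Gamma$. *Scheme.* Find $u(t)$ (a two-component grid function) and $v(t)\in V$ with, for $t\in(0,T]$, $$\begin{aligned}\rho_uu_{tt}={}&L_1\mathcal D_{xx}u+L_3\mathcal D_{yy}u+(L_2+L_2^T)\mathcal D_x\mathcal D_yu-\mathcal H_x^{-1}\mathcal B_x\mathcal T_xu-\mathcal H_y^{-1}\mathcal B_{N}\mathcal T_yu\\&+\mathcal H^{-1}\big[-\tfrac12\mathcal B_\Gamma\mathcal H_x(\mathcal T_uu+P^b_{v2u}T_vv)+\tfrac12\mathcal T_u^T\mathcal H_x(u_\Gamma-P^g_{v2u}v_\Gamma)\big]\\&-\mathcal H^{-1}\big[\chi_1\tfrac{\alpha_u}{h_v}\mathcal B_\Gamma\mathcal H_xP^b_{v2u}(P^g_{u2v}u_\Gamma-v_\Gamma)+\chi_2\tfrac{\beta_u}{h_u}\mathcal B_\Gamma\mathcal H_x(u_\Gamma-P^g_{v2u}v_\Gamma)\big]\end{aligned}$$ and, for all $\varphi\in V$, $$\begin{aligned}(\rho_vv_{tt},\varphi)_{\Omega_v}={}&-\lambda_v(\nabla\!\cdot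 v,\nabla\!\cdot\varphi)_{\Omega_v}-2\mu_v(\varepsilon(v),\varepsilon(\varphi))_{\Omega_v}+F(v,\varphi)\\&+\tfrac12(v-P^g_{u2v}u_\Gamma,\sigma(\varphi)n)_\Gamma+\tfrac12(\sigma(v)n-P^b_{u2v}\mathcal T_uu,\varphi)_\Gamma\\&-\chi_1\tfrac{\alpha_v}{h_v}(v-P^g_{u2v}u_\Gamma,\varphi)_\Gamma-\chi_2\tfrac{\beta_v}{h_u}(P^b_{u2v}P^g_{v2u}v_\Gamma-P^b_{u2v}u_\Gamma,\varphi)_\Gamma,\quad n=(0,1)^T.\end{aligned}$$ Here $F$ is the interior penalty form on the set $\mathcal E^I$ of interior edges, $$F(v,\varphi)=\sum_{\gamma\in\mathcal E^I}\int_\gamma\{\sigma(v)n^+\}\cdot[\varphi]+\{\sigma(\varphi)n^+\}\cdot[v]-\tfrac{\alpha_I}{h_v}\chi_1[v]\cdot[\varphi],$$ with averages $\{\cdot\}$, jumps $[\varphi]=s(\varphi^+-\varphi^-)$ and an arbitrary fixed real $s$ ($s=1$: the usual jump; $s=\tfrac12$: half of it; $s=0$: interior fluxes suppressed). *Energy.*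 Let $E=\rho_uu_t^T\mathcal Hu_t+(\rho_vv_t,v_t)_{\Omega_v}$ and, with $\|\cdot\|_{M_\Gamma}$, $\|\cdot\|_{H_x}$ the norms along $\Gamma$ summed over both components, $$\begin{aligned}U_1&=2\mu_v\|\varepsilon(v)\|^2_{\Omega_v}+\lambda_v\|\nabla\!\cdot v\|^2_{\Omega_v}-F(v,v)+\chi_1\tfrac{\alpha_v}{h_v}\|v_\Gamma-P^g_{u2v}u_\Gamma\|^2_{M_\Gamma}-(v_\Gamma-P^g_{u2v}u_\Gamma)^TM_\Gamma T_vv,\\U_2&=u^T\mathcal Uu+\chi_2\tfrac{\beta_u}{h_u}\|u_\Gamma-P^g_{v2u}v_\Gamma\|^2_{H_x}-(u_\Gamma-P^g_{v2u}v_\Gamma)^T\mathcal H_x\mathcal T_uu,\end{aligned}$$ $$\mathcal U=L_1\mathcal D_x^T\mathcal H\mathcal D_x+L_3\mathcal D_y^T\mathcal H\mathcal D_y+L_2\mathcal D_x^T\mathcal H\mathcal D_y+L_2^T\mathcal D_y^T\mathcal H\mathcal D_x+L_1\mathcal H_y\mathcal R_x+L_3\mathcal H_x\mathcal R_y.$$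 **Theorem.** For every degree $q$ and every $\kappa$ there is a constant $C>0$, depending only on $q$ and on the mesh quality bound $\kappa$, such that the following holds for every scheme as above with $h_K\le\kappa\,r_K$ for all $K$. Let $C'=1/\big(h_u(H_y^{-1})_{00}\big)$ be the boundary weight of the SBP norm $H_y$, i.e. the largest number with $f^TH_yf\ge C'h_uf_0^2$ for all grid functions $f$ in the $y$-direction. (For diagonal $H_y$ it is $(H_y)_{00}/h_u$; for the standard operators on grids with equal spacings it is a number depending only on the order, e.g. $\tfrac12$ for order $2$.) If $\alpha_u=\alpha_v\ge\frac1{4C}$, $\alpha_I\ge\frac1{4C}$ and $\beta_u=\beta_v\ge\frac1{4C'}$, then $U_1\ge0$ and $U_2\ge0$ for all states $(u,v)$, and $E+U_1+U_2$ is constant in time along every solution of the coupled scheme. -/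

import Mathlib

open Matrix
open scoped Kronecker

noncomputable section

namespace ElasticFDDG

/-! ### Summation-by-parts operators in one space dimension

A uniform grid with `n + 1` points is indexed by `Fin (n + 1)`. -/

/-- Selects the left (resp. southern) end point. -/
def B0 (n : ℕ) : Matrix (Fin (n + 1)) (Fin (n + 1)) ℝ := Matrix.single 0 0 1

/-- Selects the right (resp. northern) end point. -/
def Bn (n : ℕ) : Matrix (Fin (n + 1)) (Fin (n + 1)) ℝ :=
  Matrix.single (Fin.last n) (Fin.last n) 1

/-- The boundary matrix `diag(-1, 0, …, 0, 1)`. -/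
def Bmat (n : ℕ) : Matrix (Fin (n + 1)) (Fin (n + 1)) ℝ := Bn n - B0 n

/-- SBP property of a first-derivative operator with symmetric positive definite norm `H`. -/
structure IsSBP {n : ℕ} (H D1 : Matrix (Fin (n + 1)) (Fin (n + 1)) ℝ) : Prop where
  posDef : H.PosDef
  sbp : H * D1 + (H * D1)ᵀ = Bmat n

/-- `D1`, `D2` are compatible SBP operators with boundary derivative `S` and remainder `R`. -/
structure IsCompatible {n : ℕ} (H D1 D2 S R : Matrix (Fin (n + 1)) (Fin (n + 1)) ℝ) : Prop where
  isSBP : IsSBP H D1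
  remainder : R.PosSemidef
  second : D2 = H⁻¹ * (-(D1ᵀ * H * D1) - R + Bmat n * S)

/-- Full compatibility: the boundary derivative is `D1` itself. -/
def IsFullyCompatible {n : ℕ} (H D1 D2 R : Matrix (Fin (n + 1)) (Fin (n + 1)) ℝ) : Prop :=
  IsCompatible H D1 D2 D1 R

/-- The dimensionless boundary weight of the SBP norm `H` relative to the length `h`: the largest
`c` with `c * h * (f 0) ^ 2 ≤ fᵀ H f` for all grid functions `f`.
For a diagonal norm this is the first diagonal entry of `H` divided by `h`
(see `sbpBoundaryConst_diagonal`). -/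
def sbpBoundaryConst {n : ℕ} (H : Matrix (Fin (n + 1)) (Fin (n + 1)) ℝ) (h : ℝ) : ℝ :=
  1 / (h * H⁻¹ 0 0)

theorem sbpBoundaryConst_diagonal {n : ℕ} (w : Fin (n + 1) → ℝ) (hw : ∀ i, w i ≠ 0) (h : ℝ) :
    sbpBoundaryConst (Matrix.diagonal w) h = w 0 / h := by
  have hinv : (Matrix.diagonal w)⁻¹ = Matrix.diagonal (fun i => (w i)⁻¹) := by
    apply Matrix.inv_eq_right_inv
    rw [Matrix.diagonal_mul_diagonal]
    simp [hw]
  unfold sbpBoundaryConst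
  rw [hinv, Matrix.diagonal_apply_eq, one_div, mul_inv, inv_inv, mul_comm, div_eq_mul_inv]

/-! ### Polynomials of degree at most `q` in two variables -/

/-- Exponents `(i, j)` with `i + j ≤ q`. -/
abbrev Mono (q : ℕ) : Type := {p : Fin (q + 1) × Fin (q + 1) // (p.1 : ℕ) + (p.2 : ℕ) ≤ q}

variable {q : ℕ}

/-- Value at `p = (x, y)` of the polynomial `∑ c_{ij} x^i y^j`. -/
def polyVal (c : Mono q → ℝ) (p : ℝ × ℝ) : ℝ :=
  ∑ m : Mono q, c m * (p.1 ^ (m.1.1 : ℕ) * p.2 ^ (m.1.2 : ℕ))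

/-- Its partial derivative in `x`. -/
def polyDx (c : Mono q → ℝ) (p : ℝ × ℝ) : ℝ :=
  ∑ m : Mono q, c m * (((m.1.1 : ℕ) : ℝ) * p.1 ^ ((m.1.1 : ℕ) - 1) * p.2 ^ (m.1.2 : ℕ))

/-- Its partial derivative in `y`. -/
def polyDy (c : Mono q → ℝ) (p : ℝ × ℝ) : ℝ :=
  ∑ m : Mono q, c m * (p.1 ^ (m.1.1 : ℕ) * (((m.1.2 : ℕ) : ℝ) * p.2 ^ ((m.1.2 : ℕ) - 1)))

theorem hasDerivAt_polyVal_fst (c : Mono q → ℝ) (x y : ℝ) :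
    HasDerivAt (fun s => polyVal c (s, y)) (polyDx c (x, y)) x := by
  unfold polyVal polyDx
  apply HasDerivAt.fun_sum
  intro m _
  exact ((hasDerivAt_pow (m.1.1 : ℕ) x).mul_const (y ^ (m.1.2 : ℕ))).const_mul (c m)

theorem hasDerivAt_polyVal_snd (c : Mono q → ℝ) (x y : ℝ) :
    HasDerivAt (fun s => polyVal c (x, s)) (polyDy c (x, y)) y := by
  unfold polyVal polyDy
  apply HasDerivAt.fun_sum
  intro m _
  exact ((hasDerivAt_pow (m.1.2 : ℕ) y).const_mul (x ^ (m.1.1 : ℕ))).const_mul (c m)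

/-- The Jacobian `(∂_j w_i)` of a polynomial vector field. -/
def jac (w : Fin 2 → Mono q → ℝ) (p : ℝ × ℝ) : Matrix (Fin 2) (Fin 2) ℝ :=
  !![polyDx (w 0) p, polyDy (w 0) p; polyDx (w 1) p, polyDy (w 1) p]

/-- Divergence. -/
def divergence (w : Fin 2 → Mono q → ℝ) (p : ℝ × ℝ) : ℝ := (jac w p).trace

/-- Strain tensor: the symmetric part of the Jacobian. -/
def strain (w : Fin 2 → Mono q → ℝ) (p : ℝ × ℝ) : Matrix (Fin 2) (Fin 2) ℝ :=
  (1 / 2 : ℝ) • (jac w p + (jac w p)ᵀ)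

/-- Stress tensor with Lamé parameters `mu`, `la`. -/
def stress (mu la : ℝ) (w : Fin 2 → Mono q → ℝ) (p : ℝ × ℝ) : Matrix (Fin 2) (Fin 2) ℝ :=
  !![(2 * mu + la) * polyDx (w 0) p + la * polyDy (w 1) p,
      mu * (polyDy (w 0) p + polyDx (w 1) p);
    mu * (polyDy (w 0) p + polyDx (w 1) p),
      (2 * mu + la) * polyDy (w 1) p + la * polyDx (w 0) p]

/-- Contraction `A : B`. -/
def contract (A B : Matrix (Fin 2) (Fin 2) ℝ) : ℝ := ∑ i, ∑ j, A i j * B i j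

/-! ### Triangulations -/

/-- A conforming triangulation of a bounded planar domain: finitely many distinct, nondegenerate,
counterclockwise triangles, any two of which meet exactly in their common face. -/
structure TriMesh where
  card : ℕ
  vert : Fin card → Fin 3 → ℝ × ℝ
  ccw : ∀ K, 0 < ((vert K 1).1 - (vert K 0).1) * ((vert K 2).2 - (vert K 0).2)
    - ((vert K 1).2 - (vert K 0).2) * ((vert K 2).1 - (vert K 0).1)
  distinct : Function.Injective fun K => Set.range (vert K)
  conforming : ∀ K L, convexHull ℝ (Set.range (vert K)) ∩ convexHull ℝ (Set.range (vert L))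
    = convexHull ℝ (Set.range (vert K) ∩ Set.range (vert L))

namespace TriMesh

variable (M : TriMesh)

/-- The closed triangle `K`. -/
def tri (K : Fin M.card) : Set (ℝ × ℝ) := convexHull ℝ (Set.range (M.vert K))

/-- The triangulated domain (closed). -/
def domain : Set (ℝ × ℝ) := ⋃ K, M.tri K

/-- Area of the triangle `K`. -/
def area (K : Fin M.card) : ℝ :=
  (((M.vert K 1).1 - (M.vert K 0).1) * ((M.vert K 2).2 - (M.vert K 0).2)
    - ((M.vert K 1).2 - (M.vert K 0).2) * ((M.vert K 2).1 - (M.vert K 0).1)) / 2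

/-- Side `i` of `K` is opposite to vertex `i`; it runs from `sideStart` to `sideEnd`
(indices modulo 3), so the boundary of `K` is traversed counterclockwise. -/
def sideStart (K : Fin M.card) (i : Fin 3) : ℝ × ℝ := M.vert K (i + 1)

/-- See `sideStart`. -/
def sideEnd (K : Fin M.card) (i : Fin 3) : ℝ × ℝ := M.vert K (i + 2)

/-- Affine parametrization of a side by `[0, 1]`. -/
def sidePt (K : Fin M.card) (i : Fin 3) (s : ℝ) : ℝ × ℝ :=
  M.sideStart K i + s • (M.sideEnd K i - M.sideStart K i)

/-- Euclidean length of a side. -/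
def sideLen (K : Fin M.card) (i : Fin 3) : ℝ :=
  Real.sqrt (((M.sideEnd K i).1 - (M.sideStart K i).1) ^ 2
    + ((M.sideEnd K i).2 - (M.sideStart K i).2) ^ 2)

/-- Outward unit normal of `K` on side `i`. -/
def normal (K : Fin M.card) (i : Fin 3) : Fin 2 → ℝ :=
  ![((M.sideEnd K i).2 - (M.sideStart K i).2) / M.sideLen K i,
    -((M.sideEnd K i).1 - (M.sideStart K i).1) / M.sideLen K i]

/-- Diameter of `K`, that is, its longest side. -/
def hK (K : Fin M.card) : ℝ := max (M.sideLen K 0) (max (M.sideLen K 1) (M.sideLen K 2))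

/-- Inradius of `K`. -/
def inradius (K : Fin M.card) : ℝ :=
  2 * M.area K / (M.sideLen K 0 + M.sideLen K 1 + M.sideLen K 2)

/-- The smallest element size. -/
def hmin : ℝ := ⨅ K, M.hK K

/-- Mesh quality: every element has aspect ratio (diameter over inradius) at most `κ`. -/
def ShapeRegular (κ : ℝ) : Prop := ∀ K, M.hK K ≤ κ * M.inradius K

/-- Line integral over a side, the integrand being given in the parameter of `sidePt`. -/
def sideIntegral (K : Fin M.card) (i : Fin 3) (f : ℝ → ℝ) : ℝ :=
  M.sideLen K i * ∫ s in (0 : ℝ)..1, f s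

/-- The interior edges, each listed once as `((K⁺, i), (K⁻, j))` with `K⁺ < K⁻`.
Two neighbouring counterclockwise triangles traverse their common edge in opposite directions. -/
def interiorEdges : Finset ((Fin M.card × Fin 3) × (Fin M.card × Fin 3)) :=
  open Classical in
  Finset.univ.filter fun e => e.1.1 < e.2.1
    ∧ M.sideStart e.1.1 e.1.2 = M.sideEnd e.2.1 e.2.2
    ∧ M.sideEnd e.1.1 e.1.2 = M.sideStart e.2.1 e.2.2

/-- The sides contained in the horizontal segment `[a, b] × {y₀}`. -/
abbrev IfaceSide (a b y₀ : ℝ) : Type :=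
  {e : Fin M.card × Fin 3 // M.sideStart e.1 e.2 ∈ Set.Icc a b ×ˢ {y₀}
    ∧ M.sideEnd e.1 e.2 ∈ Set.Icc a b ×ˢ {y₀}}

instance (a b y₀ : ℝ) : Fintype (M.IfaceSide a b y₀) := Fintype.ofFinite _

end TriMesh

/-- The discontinuous piecewise polynomial vector fields of degree at most `q`, given by the
coefficients on each triangle of each of the two components. -/
abbrev DGSpace (M : TriMesh) (q : ℕ) : Type := Fin M.card → Fin 2 → Mono q → ℝ

/-! ### The coupled semi-discretization -/

/-- All data of the coupled scheme. The suffixes `u` and `v` refer to the finite difference domain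
`Ω_u = [a, b] × [y₀, y₁]` and to the discontinuous Galerkin domain `Ω_v`, which lies on the other
side of the interface `Γ = [a, b] × {y₀}`. -/
structure CoupledScheme (q : ℕ) where
  mesh : TriMesh
  a : ℝ
  b : ℝ
  y₀ : ℝ
  y₁ : ℝ
  /-- number of grid intervals in each direction -/
  Nx : ℕ
  Ny : ℕ
  /-- SBP norm, first and second derivative, boundary derivative and remainder in `x` -/
  Hx : Matrix (Fin (Nx + 1)) (Fin (Nx + 1)) ℝ
  Dx : Matrix (Fin (Nx + 1)) (Fin (Nx + 1)) ℝ
  Dxx : Matrix (Fin (Nx + 1)) (Fin (Nx + 1)) ℝ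
  Sx : Matrix (Fin (Nx + 1)) (Fin (Nx + 1)) ℝ
  Rx : Matrix (Fin (Nx + 1)) (Fin (Nx + 1)) ℝ
  /-- SBP norm, first and second derivative and remainder in `y` -/
  Hy : Matrix (Fin (Ny + 1)) (Fin (Ny + 1)) ℝ
  Dy : Matrix (Fin (Ny + 1)) (Fin (Ny + 1)) ℝ
  Dyy : Matrix (Fin (Ny + 1)) (Fin (Ny + 1)) ℝ
  Ry : Matrix (Fin (Ny + 1)) (Fin (Ny + 1)) ℝ
  /-- nodes, in the parameter interval of an edge, of the local nodal basis -/
  nodes : Fin (q + 1) → ℝ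
  /-- good and bad projections between the grid on `Γ` and the nodal coefficients of the
  piecewise polynomials on the edges along `Γ` -/
  Pguv : Matrix (mesh.IfaceSide a b y₀ × Fin (q + 1)) (Fin (Nx + 1)) ℝ
  Pbuv : Matrix (mesh.IfaceSide a b y₀ × Fin (q + 1)) (Fin (Nx + 1)) ℝ
  Pgvu : Matrix (Fin (Nx + 1)) (mesh.IfaceSide a b y₀ × Fin (q + 1)) ℝ
  Pbvu : Matrix (Fin (Nx + 1)) (mesh.IfaceSide a b y₀ × Fin (q + 1)) ℝ
  /-- densities and Lamé parameters -/
  rhou : ℝ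
  muu : ℝ
  lau : ℝ
  rhov : ℝ
  muv : ℝ
  lav : ℝ
  /-- penalty parameters of the interface coupling -/
  alphau : ℝ
  alphav : ℝ
  betau : ℝ
  betav : ℝ
  /-- penalty parameter on the interior edges of the triangulation -/
  alphaI : ℝ
  /-- the jump across an interior edge is `jumpScale * (φ⁺ - φ⁻)`: the usual jump for `1`, its half
  for `1 / 2`, and no interior fluxes at all for `0` -/
  jumpScale : ℝ

namespace CoupledScheme

variable (S : CoupledScheme q)

/-- Index set of the scalar grid functions on `Ω_u`; `(i, 0)` is the `i`-th node on `Γ`. -/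
abbrev GridIdx : Type := Fin (S.Nx + 1) × Fin (S.Ny + 1)

/-- Vector-valued grid functions on `Ω_u`. -/
abbrev Grid : Type := Fin 2 × S.GridIdx → ℝ

/-- Square matrices of full size. -/
abbrev FullMat : Type := Matrix (Fin 2 × S.GridIdx) (Fin 2 × S.GridIdx) ℝ

/-- Edges of the triangulation along `Γ`. -/
abbrev GEdge : Type := S.mesh.IfaceSide S.a S.b S.y₀

/-- Index set of the nodal degrees of freedom along `Γ` of a scalar piecewise polynomial. -/
abbrev GDof : Type := S.GEdge × Fin (q + 1)

/-- Nodal values along `Γ` of vector-valued piecewise polynomials. -/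
abbrev GVec : Type := Fin 2 × S.GDof → ℝ

/-- `χ₁ = 2 μ_v + λ_v`. -/
def chi1 : ℝ := 2 * S.muv + S.lav

/-- `χ₂ = 2 μ_u + λ_u`. -/
def chi2 : ℝ := 2 * S.muu + S.lau

/-- Spacing of the finite difference grid along `Γ`. -/
def hu : ℝ := (S.b - S.a) / S.Nx

/-- Smallest element size of the triangulation. -/
def hv : ℝ := S.mesh.hmin

/-- The geometric setting: `Ω_u` is a rectangle lying on the horizontal interface `Γ`, the two
domains meet exactly in `Γ`, and `Γ` is a union of edges of the triangulation. -/
structure ValidGeometry : Prop where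
  ab : S.a < S.b
  yy : S.y₀ < S.y₁
  nx : 0 < S.Nx
  ny : 0 < S.Ny
  contact : (Set.Icc S.a S.b ×ˢ Set.Icc S.y₀ S.y₁) ∩ S.mesh.domain = Set.Icc S.a S.b ×ˢ {S.y₀}
  meshed : (⋃ e : S.GEdge, segment ℝ (S.mesh.sideStart e.1.1 e.1.2) (S.mesh.sideEnd e.1.1 e.1.2))
    = Set.Icc S.a S.b ×ˢ {S.y₀}

/-! #### Full-size finite difference operators -/

/-- An operator acting along `x`. -/
def alongX (F : Matrix (Fin (S.Nx + 1)) (Fin (S.Nx + 1)) ℝ) : S.FullMat :=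
  (1 : Matrix (Fin 2) (Fin 2) ℝ) ⊗ₖ (F ⊗ₖ (1 : Matrix (Fin (S.Ny + 1)) (Fin (S.Ny + 1)) ℝ))

/-- An operator acting along `y`. -/
def alongY (F : Matrix (Fin (S.Ny + 1)) (Fin (S.Ny + 1)) ℝ) : S.FullMat :=
  (1 : Matrix (Fin 2) (Fin 2) ℝ) ⊗ₖ ((1 : Matrix (Fin (S.Nx + 1)) (Fin (S.Nx + 1)) ℝ) ⊗ₖ F)

/-- A material matrix acting on the two components. -/
def onComponents (L : Matrix (Fin 2) (Fin 2) ℝ) : S.FullMat :=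
  L ⊗ₖ ((1 : Matrix (Fin (S.Nx + 1)) (Fin (S.Nx + 1)) ℝ) ⊗ₖ
    (1 : Matrix (Fin (S.Ny + 1)) (Fin (S.Ny + 1)) ℝ))

def L1 : S.FullMat := S.onComponents !![2 * S.muu + S.lau, 0; 0, S.muu]

def L2 : S.FullMat := S.onComponents !![0, S.lau; S.muu, 0]

def L3 : S.FullMat := S.onComponents !![S.muu, 0; 0, 2 * S.muu + S.lau]

/-- The two-dimensional SBP norm. -/
def H : S.FullMat := S.alongX S.Hx * S.alongY S.Hy

/-- Restriction to the interface, which is the southern boundary of `Ω_u`. -/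
def BG : S.FullMat := S.alongY (B0 S.Ny)

/-- Traction operator for the lateral boundaries. Its normal derivative is the boundary derivative
`Sx` belonging to `Dxx`, which is `Dx` if `Dx`, `Dxx` are fully compatible. -/
def Tx : S.FullMat := S.L1 * S.alongX S.Sx + S.L2 * S.alongY S.Dy

/-- Traction operator for the horizontal boundaries. -/
def Ty : S.FullMat := S.L3 * S.alongY S.Dy + S.L2ᵀ * S.alongX S.Dx

/-- Traction on `Γ` with respect to the outward normal `(0, -1)` of `Ω_u`. -/
def Tu : S.FullMat := -(S.BG * S.Ty)

/-! #### Interface quantities of the discontinuous Galerkin side -/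

/-- Local nodal basis of an edge, in the parameter of `TriMesh.sidePt`. -/
def nodal (k : Fin (q + 1)) (s : ℝ) : ℝ := (Lagrange.basis Finset.univ S.nodes k).eval s

/-- Mass matrix of the scalar piecewise polynomials along `Γ`. -/
def massG : Matrix S.GDof S.GDof ℝ := fun d d' =>
  if d.1 = d'.1 then
    S.mesh.sideIntegral d.1.1.1 d.1.1.2 fun s => S.nodal d.2 s * S.nodal d'.2 s
  else 0

/-- Full-size mass matrix along `Γ`. -/
def MG : Matrix (Fin 2 × S.GDof) (Fin 2 × S.GDof) ℝ :=
  (1 : Matrix (Fin 2) (Fin 2) ℝ) ⊗ₖ S.massG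

/-- Nodal values of `v` along `Γ`. -/
def traceG (v : DGSpace S.mesh q) : S.GVec := fun d =>
  polyVal (v d.2.1.1.1 d.1) (S.mesh.sidePt d.2.1.1.1 d.2.1.1.2 (S.nodes d.2.2))

/-- Traction `σ(v) n` along `Γ`, with the outward normal `n = (0, 1)` of `Ω_v`. -/
def tractionG (v : DGSpace S.mesh q) (K : Fin S.mesh.card) (p : ℝ × ℝ) : Fin 2 → ℝ :=
  stress S.muv S.lav (v K) p *ᵥ ![0, 1]

/-- Nodal values along `Γ` of the traction of `v`. -/
def Tv (v : DGSpace S.mesh q) : S.GVec := fun d =>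
  S.tractionG v d.2.1.1.1 (S.mesh.sidePt d.2.1.1.1 d.2.1.1.2 (S.nodes d.2.2)) d.1

/-- Full-size projection from the grid to the edges along `Γ`. -/
def projUV (P : Matrix S.GDof (Fin (S.Nx + 1)) ℝ) :
    Matrix (Fin 2 × S.GDof) (Fin 2 × S.GridIdx) ℝ :=
  (1 : Matrix (Fin 2) (Fin 2) ℝ) ⊗ₖ
    (Matrix.of fun d (p : S.GridIdx) => if p.2 = 0 then P d p.1 else 0)

/-- Full-size projection from the edges along `Γ` to the grid. -/
def projVU (P : Matrix (Fin (S.Nx + 1)) S.GDof ℝ) :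
    Matrix (Fin 2 × S.GridIdx) (Fin 2 × S.GDof) ℝ :=
  (1 : Matrix (Fin 2) (Fin 2) ℝ) ⊗ₖ
    (Matrix.of fun (p : S.GridIdx) d => if p.2 = 0 then P p.1 d else 0)

/-- Norm compatibility of a pair of projections between the grid on `Γ` (with norm `Hx`) and the
piecewise polynomials along `Γ` (with their mass matrix). -/
def NormCompatible (Puv : Matrix S.GDof (Fin (S.Nx + 1)) ℝ)
    (Pvu : Matrix (Fin (S.Nx + 1)) S.GDof ℝ) : Prop :=
  S.massG * Puv = (S.Hx * Pvu)ᵀ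

/-! #### The finite difference equations -/

/-- Spatial operator in the interior, with the terms that impose zero traction on the eastern,
western and northern boundary. -/
def fdBulk (u : S.Grid) : S.Grid :=
  (S.L1 * S.alongX S.Dxx + S.L3 * S.alongY S.Dyy
      + (S.L2 + S.L2ᵀ) * (S.alongX S.Dx * S.alongY S.Dy)
    - (S.alongX S.Hx)⁻¹ * S.alongX (Bmat S.Nx) * S.Tx
    - (S.alongY S.Hy)⁻¹ * S.alongY (Bn S.Ny) * S.Ty) *ᵥ u

/-- Terms imposing continuity of traction and displacement on `Γ`. -/
def fdCoupling (u : S.Grid) (v : DGSpace S.mesh q) : S.Grid :=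
  S.H⁻¹ *ᵥ
    (-((1 / 2 : ℝ) • ((S.BG * S.alongX S.Hx) *ᵥ (S.Tu *ᵥ u + S.projVU S.Pbvu *ᵥ S.Tv v)))
      + (1 / 2 : ℝ) • ((S.Tuᵀ * S.alongX S.Hx) *ᵥ
          (S.BG *ᵥ u - S.projVU S.Pgvu *ᵥ S.traceG v)))

/-- Penalty terms on `Γ`. -/
def fdPenalty (u : S.Grid) (v : DGSpace S.mesh q) : S.Grid :=
  S.H⁻¹ *ᵥ
    ((S.chi1 * S.alphau / S.hv) • ((S.BG * S.alongX S.Hx * S.projVU S.Pbvu) *ᵥ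
        (S.projUV S.Pguv *ᵥ (S.BG *ᵥ u) - S.traceG v))
      + (S.chi2 * S.betau / S.hu) • ((S.BG * S.alongX S.Hx) *ᵥ
          (S.BG *ᵥ u - S.projVU S.Pgvu *ᵥ S.traceG v)))

/-- The finite difference equations. -/
def FDEquation (u utt : S.Grid) (v : DGSpace S.mesh q) : Prop :=
  S.rhou • utt = S.fdBulk u + S.fdCoupling u v - S.fdPenalty u v

/-! #### The discontinuous Galerkin equations -/

/-- `L²(Ω_v)` inner product. -/
def innerV (v w : DGSpace S.mesh q) : ℝ :=
  ∑ K, ∫ p in S.mesh.tri K, ∑ c, polyVal (v K c) p * polyVal (w K c) p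

/-- `(ε(v), ε(w))_{Ω_v}`. -/
def innerStrain (v w : DGSpace S.mesh q) : ℝ :=
  ∑ K, ∫ p in S.mesh.tri K, contract (strain (v K) p) (strain (w K) p)

/-- `(∇·v, ∇·w)_{Ω_v}`. -/
def innerDiv (v w : DGSpace S.mesh q) : ℝ :=
  ∑ K, ∫ p in S.mesh.tri K, divergence (v K) p * divergence (w K) p

/-- Traction of the piece of `v` on `K`, with respect to a given normal. -/
def tractionOn (v : DGSpace S.mesh q) (K : Fin S.mesh.card) (n : Fin 2 → ℝ) (p : ℝ × ℝ) :
    Fin 2 → ℝ :=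
  stress S.muv S.lav (v K) p *ᵥ n

/-- Average of the two tractions on an interior edge, with the unit normal pointing out of `K⁺`. -/
def avgTraction (v : DGSpace S.mesh q)
    (e : (Fin S.mesh.card × Fin 3) × (Fin S.mesh.card × Fin 3)) (s : ℝ) : Fin 2 → ℝ :=
  (1 / 2 : ℝ) •
    (S.tractionOn v e.1.1 (S.mesh.normal e.1.1 e.1.2) (S.mesh.sidePt e.1.1 e.1.2 s)
      + S.tractionOn v e.2.1 (S.mesh.normal e.1.1 e.1.2) (S.mesh.sidePt e.1.1 e.1.2 s))

/-- Jump across an interior edge. -/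
def jump (v : DGSpace S.mesh q)
    (e : (Fin S.mesh.card × Fin 3) × (Fin S.mesh.card × Fin 3)) (s : ℝ) : Fin 2 → ℝ := fun c =>
  S.jumpScale * (polyVal (v e.1.1 c) (S.mesh.sidePt e.1.1 e.1.2 s)
    - polyVal (v e.2.1 c) (S.mesh.sidePt e.1.1 e.1.2 s))

/-- Symmetric interior penalty fluxes on the interior edges. -/
def interiorFlux (v w : DGSpace S.mesh q) : ℝ :=
  ∑ e ∈ S.mesh.interiorEdges, S.mesh.sideIntegral e.1.1 e.1.2 fun s =>
    S.avgTraction v e s ⬝ᵥ S.jump w e s + S.avgTraction w e s ⬝ᵥ S.jump v e s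
      - S.alphaI / S.hv * (2 * S.muv + S.lav) * (S.jump v e s ⬝ᵥ S.jump w e s)

/-- The vector-valued polynomial on the edge `e ⊂ Γ` with nodal values `g`. -/
def edgeFun (g : S.GVec) (e : S.GEdge) (s : ℝ) : Fin 2 → ℝ := fun c =>
  ∑ k, g (c, (e, k)) * S.nodal k s

/-- The trace of `v` on the edge `e ⊂ Γ`. -/
def edgeTrace (v : DGSpace S.mesh q) (e : S.GEdge) (s : ℝ) : Fin 2 → ℝ := fun c =>
  polyVal (v e.1.1 c) (S.mesh.sidePt e.1.1 e.1.2 s)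

/-- The traction of `v` on the edge `e ⊂ Γ`. -/
def edgeTraction (v : DGSpace S.mesh q) (e : S.GEdge) (s : ℝ) : Fin 2 → ℝ :=
  S.tractionG v e.1.1 (S.mesh.sidePt e.1.1 e.1.2 s)

/-- `∑_γ (f, g)_γ` over the edges along `Γ`. -/
def innerEdges (f g : S.GEdge → ℝ → Fin 2 → ℝ) : ℝ :=
  ∑ e : S.GEdge, S.mesh.sideIntegral e.1.1 e.1.2 fun s => f e s ⬝ᵥ g e s

/-- The discontinuous Galerkin equations, tested with every `w`. -/
def DGEquation (u : S.Grid) (v vtt : DGSpace S.mesh q) : Prop :=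
  ∀ w : DGSpace S.mesh q,
    S.rhov * S.innerV vtt w =
      -(S.lav * S.innerDiv v w) - 2 * S.muv * S.innerStrain v w
      + S.interiorFlux v w
      + 1 / 2 * S.innerEdges
          (fun e s => S.edgeTrace v e s - S.edgeFun (S.projUV S.Pguv *ᵥ (S.BG *ᵥ u)) e s)
          (S.edgeTraction w)
      + 1 / 2 * S.innerEdges
          (fun e s => S.edgeTraction v e s - S.edgeFun (S.projUV S.Pbuv *ᵥ (S.Tu *ᵥ u)) e s)
          (S.edgeTrace w)
      - S.chi1 * S.alphav / S.hv * S.innerEdges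
          (fun e s => S.edgeTrace v e s - S.edgeFun (S.projUV S.Pguv *ᵥ (S.BG *ᵥ u)) e s)
          (S.edgeTrace w)
      - S.chi2 * S.betav / S.hu * S.innerEdges
          (fun e s =>
            S.edgeFun (S.projUV S.Pbuv *ᵥ (S.projVU S.Pgvu *ᵥ S.traceG v)) e s
              - S.edgeFun (S.projUV S.Pbuv *ᵥ (S.BG *ᵥ u)) e s)
          (S.edgeTrace w)

/-- `(u, v)`, with first and second time derivatives `(ut, vt)` and `(utt, vtt)`, solves the coupled
semi-discretization on `(0, T]` and is continuous, together with `(ut, vt)`, up to the initial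
time. -/
structure IsSolution (T : ℝ) (u ut utt : ℝ → S.Grid) (v vt vtt : ℝ → DGSpace S.mesh q) :
    Prop where
  cont_u : ContinuousOn u (Set.Icc 0 T)
  cont_ut : ContinuousOn ut (Set.Icc 0 T)
  cont_v : ContinuousOn v (Set.Icc 0 T)
  cont_vt : ContinuousOn vt (Set.Icc 0 T)
  deriv_u : ∀ t ∈ Set.Ioc 0 T, HasDerivWithinAt u (ut t) (Set.Icc 0 T) t
  deriv_ut : ∀ t ∈ Set.Ioc 0 T, HasDerivWithinAt ut (utt t) (Set.Icc 0 T) t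
  deriv_v : ∀ t ∈ Set.Ioc 0 T, HasDerivWithinAt v (vt t) (Set.Icc 0 T) t
  deriv_vt : ∀ t ∈ Set.Ioc 0 T, HasDerivWithinAt vt (vtt t) (Set.Icc 0 T) t
  fd : ∀ t ∈ Set.Ioc 0 T, S.FDEquation (u t) (utt t) (v t)
  dg : ∀ t ∈ Set.Ioc 0 T, S.DGEquation (u t) (v t) (vtt t)

/-! #### The discrete energy -/

/-- The kinetic part `E`. -/
def kinetic (ut : S.Grid) (vt : DGSpace S.mesh q) : ℝ :=
  S.rhou * (ut ⬝ᵥ S.H *ᵥ ut) + S.rhov * S.innerV vt vt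

/-- The part `U₁` belonging to the discontinuous Galerkin side. -/
def U1 (u : S.Grid) (v : DGSpace S.mesh q) : ℝ :=
  2 * S.muv * S.innerStrain v v + S.lav * S.innerDiv v v - S.interiorFlux v v
    + S.chi1 * S.alphav / S.hv *
      (S.traceG v ⬝ᵥ S.MG *ᵥ S.traceG v
        + (S.projUV S.Pguv *ᵥ (S.BG *ᵥ u)) ⬝ᵥ S.MG *ᵥ (S.projUV S.Pguv *ᵥ (S.BG *ᵥ u))
        - 2 * ((S.projUV S.Pguv *ᵥ (S.BG *ᵥ u)) ⬝ᵥ S.MG *ᵥ S.traceG v))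
    - S.traceG v ⬝ᵥ S.MG *ᵥ S.Tv v
    + (S.projUV S.Pguv *ᵥ (S.BG *ᵥ u)) ⬝ᵥ S.MG *ᵥ S.Tv v

/-- Elastic energy matrix of the finite difference side, including the remainders of the narrow
second-derivative operators. -/
def Umat : S.FullMat :=
  S.L2 * (S.alongX S.Dx)ᵀ * S.H * S.alongY S.Dy
    + S.L2ᵀ * (S.alongY S.Dy)ᵀ * S.H * S.alongX S.Dx
    + S.L1 * (S.alongX S.Dx)ᵀ * S.H * S.alongX S.Dx
    + S.L3 * (S.alongY S.Dy)ᵀ * S.H * S.alongY S.Dy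
    + S.L1 * S.alongY S.Hy * S.alongX S.Rx
    + S.L3 * S.alongX S.Hx * S.alongY S.Ry

/-- The part `U₂` belonging to the finite difference side. -/
def U2 (u : S.Grid) (v : DGSpace S.mesh q) : ℝ :=
  u ⬝ᵥ S.Umat *ᵥ u
    + S.chi2 * S.betau / S.hu *
      ((S.BG *ᵥ u) ⬝ᵥ S.alongX S.Hx *ᵥ (S.BG *ᵥ u)
        + (S.projVU S.Pgvu *ᵥ S.traceG v) ⬝ᵥ S.alongX S.Hx *ᵥ (S.projVU S.Pgvu *ᵥ S.traceG v)
        - 2 * ((S.BG *ᵥ u) ⬝ᵥ S.alongX S.Hx *ᵥ (S.projVU S.Pgvu *ᵥ S.traceG v)))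
    - (S.BG *ᵥ u) ⬝ᵥ S.alongX S.Hx *ᵥ (S.Tu *ᵥ u)
    + (S.Tu *ᵥ u) ⬝ᵥ S.alongX S.Hx *ᵥ (S.projVU S.Pgvu *ᵥ S.traceG v)

end CoupledScheme

end ElasticFDDG

end

/-! Two tools carry the proof: an exact discrete integration by parts, which gives conservation, and
a control of boundary tractions by interior energy, which gives positivity.

Conservation. Multiplied by the norm, the grid operator becomes minus the symmetric matrix `Umat`
plus a traction term on Γ alone (`H_mul_bulkMat`): the free-traction terms remove the contributions
of the other three sides. The equations are then tested with u_t and v_t (`FDEquation.test`,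
`DGEquation.test`). Norm compatibility makes each good projection adjoint to the bad projection in
the opposite direction, so the coupling terms of both equations are expressed in the same two inner
products on Γ, and their sum is exactly -1/2 times the time derivative of U₁ + U₂
(`energy_conserved`).

U₂ ≥ 0. The form of `Umat` dominates a discrete 2μ|ε|² + λ(div)² in the norm H_x ⊗ H_y
(`form_Umat_ge`). The matrix inequality H_y ≥ C' h_u e₀e₀ᵀ, with its sharp constant
(`posSemidef_sub_single`), transfers this density to Γ, where it forms a sum of squares together
with the penalty and the product of jump and traction (`energy_add_jump_nonneg`).

U₁ ≥ 0. Strains and divergences are polynomials along every line. A one-dimensional inequality for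
g(1), obtained by compactness (`exists_sq_eval_one_le`), is applied on the segments from a vertex to
the opposite side and integrated (`collapse_trace_le`); shape regularity turns the result into a
trace inequality scaled by h_v. Young's inequality absorbs all jumps into the penalties and leaves
tractions, hence side energies. Since a side belongs to at most one interior edge (`side_unique`),
their total is at most 10 C h_v times the sum of all side energies (`interiorFlux_le`,
`interface_ge`), and C is chosen so that the volume energy covers it. -/

noncomputable section

namespace ElasticFDDG

variable {q : ℕ}

/-! ### Threefold Kronecker products -/

section Tensor

variable {l m n : Type*}

/-- Threefold Kronecker product. -/
def tensor (L : Matrix l l ℝ) (F : Matrix m m ℝ) (G : Matrix n n ℝ) :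
    Matrix (l × m × n) (l × m × n) ℝ := L ⊗ₖ (F ⊗ₖ G)

theorem tensor_mul [Fintype l] [Fintype m] [Fintype n]
    (L L' : Matrix l l ℝ) (F F' : Matrix m m ℝ) (G G' : Matrix n n ℝ) :
    tensor L F G * tensor L' F' G' = tensor (L * L') (F * F') (G * G') := by
  simp [tensor, Matrix.mul_kronecker_mul]

theorem tensor_transpose (L : Matrix l l ℝ) (F : Matrix m m ℝ) (G : Matrix n n ℝ) :
    (tensor L F G)ᵀ = tensor Lᵀ Fᵀ Gᵀ := by
  simp [tensor, Matrix.kroneckerMap_transpose]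

theorem tensor_inv [Fintype l] [Fintype m] [Fintype n] [DecidableEq l] [DecidableEq m]
    [DecidableEq n] (L : Matrix l l ℝ) (F : Matrix m m ℝ) (G : Matrix n n ℝ) :
    (tensor L F G)⁻¹ = tensor L⁻¹ F⁻¹ G⁻¹ := by
  simp [tensor, Matrix.inv_kronecker]

theorem tensor_add_mid (L : Matrix l l ℝ) (F F' : Matrix m m ℝ) (G : Matrix n n ℝ) :
    tensor L (F + F') G = tensor L F G + tensor L F' G := by
  simp [tensor, Matrix.kronecker_add, Matrix.add_kronecker]

theorem tensor_neg_mid (L : Matrix l l ℝ) (F : Matrix m m ℝ) (G : Matrix n n ℝ) :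
    tensor L (-F) G = -tensor L F G := by
  ext i j; simp [tensor]

theorem tensor_sub_mid (L : Matrix l l ℝ) (F F' : Matrix m m ℝ) (G : Matrix n n ℝ) :
    tensor L (F - F') G = tensor L F G - tensor L F' G := by
  rw [sub_eq_add_neg, tensor_add_mid, tensor_neg_mid, sub_eq_add_neg]

theorem tensor_add_right (L : Matrix l l ℝ) (F : Matrix m m ℝ) (G G' : Matrix n n ℝ) :
    tensor L F (G + G') = tensor L F G + tensor L F G' := by
  simp [tensor, Matrix.kronecker_add]

theorem tensor_neg_right (L : Matrix l l ℝ) (F : Matrix m m ℝ) (G : Matrix n n ℝ) :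
    tensor L F (-G) = -tensor L F G := by
  ext i j; simp [tensor]

theorem tensor_sub_right (L : Matrix l l ℝ) (F : Matrix m m ℝ) (G G' : Matrix n n ℝ) :
    tensor L F (G - G') = tensor L F G - tensor L F G' := by
  rw [sub_eq_add_neg, tensor_add_right, tensor_neg_right, sub_eq_add_neg]

/-- A bilinear form with a threefold Kronecker product, component by component. -/
theorem dotProduct_tensor_mulVec [Fintype l] [Fintype m] [Fintype n]
    (L : Matrix l l ℝ) (F : Matrix m m ℝ) (G : Matrix n n ℝ) (u w : l × m × n → ℝ) :
    u ⬝ᵥ tensor L F G *ᵥ w =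
      ∑ c, ∑ c', L c c' * ((fun p => u (c, p)) ⬝ᵥ (F ⊗ₖ G) *ᵥ (fun p => w (c', p))) := by
  simp only [dotProduct, mulVec, Fintype.sum_prod_type (f := fun x : l × m × n => _), tensor,
    Matrix.kroneckerMap_apply (· * ·) L]
  refine Finset.sum_congr rfl fun c _ => ?_
  simp only [Finset.mul_sum]
  rw [Finset.sum_comm]
  refine Finset.sum_congr rfl fun c' _ => Finset.sum_congr rfl fun p _ =>
    Finset.sum_congr rfl fun p' _ => ?_
  ring

/-- Operators that act on each component separately. -/
theorem tensor_one_mulVec_apply [Fintype l] [DecidableEq l] [Fintype m] [Fintype n]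
    (F : Matrix m m ℝ) (G : Matrix n n ℝ) (u : l × m × n → ℝ) (c : l) :
    (fun p => (tensor 1 F G *ᵥ u) (c, p)) = (F ⊗ₖ G) *ᵥ (fun p => u (c, p)) := by
  funext p
  simp only [mulVec, dotProduct, Fintype.sum_prod_type (f := fun x : l × m × n => _), tensor,
    Matrix.kroneckerMap_apply (· * ·) (1 : Matrix l l ℝ), Matrix.one_apply]
  rw [Finset.sum_eq_single c]
  · simp
  · intro c' _ hc
    simp [hc.symm]
  · simp

end Tensor

/-! ### Bilinear forms given by matrices -/

section Forms

variable {m n : Type*} [Fintype m] [Fintype n]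

theorem dotProduct_mulVec_comm_of_transpose_eq {A : Matrix n n ℝ} (hA : Aᵀ = A) (f g : n → ℝ) :
    f ⬝ᵥ A *ᵥ g = g ⬝ᵥ A *ᵥ f := by
  rw [← Matrix.dotProduct_transpose_mulVec, hA]

theorem dotProduct_conj_mulVec (A : Matrix n n ℝ) (X Y : Matrix n m ℝ) (f g : m → ℝ) :
    f ⬝ᵥ (Xᵀ * A * Y) *ᵥ g = (X *ᵥ f) ⬝ᵥ A *ᵥ (Y *ᵥ g) := by
  rw [← Matrix.mulVec_mulVec, ← Matrix.mulVec_mulVec, Matrix.dotProduct_mulVec,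
    Matrix.vecMul_transpose]

theorem posSemidef_dotProduct_nonneg {A : Matrix n n ℝ} (hA : A.PosSemidef) (f : n → ℝ) :
    0 ≤ f ⬝ᵥ A *ᵥ f := by
  simpa using hA.dotProduct_mulVec_nonneg f

theorem posSemidef_transpose_eq {n : Type*} {A : Matrix n n ℝ} (hA : A.PosSemidef) : Aᵀ = A := by
  simpa [Matrix.conjTranspose_eq_transpose_of_trivial] using hA.isHermitian.eq

/-- A positive definite matrix dominates the square of a coordinate, with the sharp constant. -/
theorem posSemidef_sub_single {N : ℕ} {A : Matrix (Fin (N + 1)) (Fin (N + 1)) ℝ}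
    (hA : A.PosDef) : (A - (1 / A⁻¹ 0 0) • B0 N).PosSemidef := by
  have hpos : 0 < A⁻¹ 0 0 := hA.inv.diag_pos
  have hsym : Aᵀ = A := posSemidef_transpose_eq hA.posSemidef
  have hdet : IsUnit A.det := hA.det_pos.ne'.isUnit
  refine Matrix.PosSemidef.of_dotProduct_mulVec_nonneg ?_ fun f => ?_
  · rw [Matrix.IsHermitian, Matrix.conjTranspose_eq_transpose_of_trivial]
    simp [hsym, B0, Matrix.transpose_sub]
  -- The vector g represents evaluation at 0 in the A-inner product, and its squared A-norm is the
  -- (0,0) entry of the inverse.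
  set g : Fin (N + 1) → ℝ := A⁻¹ *ᵥ Pi.single 0 1 with hg
  have hAg : A *ᵥ g = Pi.single 0 1 := by
    rw [hg, Matrix.mulVec_mulVec, Matrix.mul_nonsing_inv _ hdet, Matrix.one_mulVec]
  have hg0 : g 0 = A⁻¹ 0 0 := by simp [hg]
  -- Removing from f its A-orthogonal projection onto g leaves a vector whose squared A-norm is
  -- exactly the form to be bounded below.
  have h := posSemidef_dotProduct_nonneg hA.posSemidef (f - (f 0 / A⁻¹ 0 0) • g)
  have hgf : g ⬝ᵥ A *ᵥ f = f 0 := by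
    rw [dotProduct_mulVec_comm_of_transpose_eq hsym, hAg]; simp
  have hfg : f ⬝ᵥ A *ᵥ g = f 0 := by rw [hAg]; simp
  have hgg : g ⬝ᵥ A *ᵥ g = A⁻¹ 0 0 := by rw [hAg]; simp [hg0]
  simp only [Matrix.mulVec_sub, Matrix.mulVec_smul, sub_dotProduct, dotProduct_sub,
    smul_dotProduct, dotProduct_smul, hgf, hfg, hgg, smul_eq_mul] at h
  have hB : f ⬝ᵥ B0 N *ᵥ f = f 0 * f 0 := by
    simp [B0, Matrix.single_mulVec, dotProduct, Function.update_apply]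
  simp only [star_trivial, Matrix.sub_mulVec, Matrix.smul_mulVec, dotProduct_sub,
    dotProduct_smul, hB, smul_eq_mul]
  have : f 0 / A⁻¹ 0 0 * f 0 - f 0 / A⁻¹ 0 0 * (f 0 / A⁻¹ 0 0 * A⁻¹ 0 0) = 0 := by
    field_simp; ring
  have e : 1 / A⁻¹ 0 0 * (f 0 * f 0) = f 0 / A⁻¹ 0 0 * f 0 := by ring
  linarith

end Forms

/-! ### Discrete integration by parts on the grid side -/

namespace CoupledScheme

variable (S : CoupledScheme q)

/-- The operator of `fdBulk`. -/
def bulkMat : S.FullMat :=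
  S.L1 * S.alongX S.Dxx + S.L3 * S.alongY S.Dyy
      + (S.L2 + S.L2ᵀ) * (S.alongX S.Dx * S.alongY S.Dy)
    - (S.alongX S.Hx)⁻¹ * S.alongX (Bmat S.Nx) * S.Tx
    - (S.alongY S.Hy)⁻¹ * S.alongY (Bn S.Ny) * S.Ty

theorem alongX_eq (F : Matrix (Fin (S.Nx + 1)) (Fin (S.Nx + 1)) ℝ) :
    S.alongX F = tensor 1 F 1 := rfl

theorem alongY_eq (F : Matrix (Fin (S.Ny + 1)) (Fin (S.Ny + 1)) ℝ) :
    S.alongY F = tensor 1 1 F := rfl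

theorem H_eq : S.H = tensor 1 S.Hx S.Hy := by
  simp [H, alongX_eq, alongY_eq, tensor_mul]

/-- Material matrices of the grid side. -/
def l1 : Matrix (Fin 2) (Fin 2) ℝ := !![2 * S.muu + S.lau, 0; 0, S.muu]
/-- See `l1`. -/
def l2 : Matrix (Fin 2) (Fin 2) ℝ := !![0, S.lau; S.muu, 0]
/-- See `l1`. -/
def l3 : Matrix (Fin 2) (Fin 2) ℝ := !![S.muu, 0; 0, 2 * S.muu + S.lau]

theorem L1_eq : S.L1 = tensor S.l1 1 1 := rfl
theorem L2_eq : S.L2 = tensor S.l2 1 1 := rfl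
theorem L3_eq : S.L3 = tensor S.l3 1 1 := rfl

/-- Component matrices, x-operators and y-operators commute with one another, so each summand
collapses to a single Kronecker product and the position of the material matrices is immaterial. -/
theorem Umat_eq : S.Umat =
    tensor S.l2 (S.Dxᵀ * S.Hx) (S.Hy * S.Dy)
    + tensor S.l2ᵀ (S.Hx * S.Dx) (S.Dyᵀ * S.Hy)
    + tensor S.l1 (S.Dxᵀ * S.Hx * S.Dx) S.Hy
    + tensor S.l3 S.Hx (S.Dyᵀ * S.Hy * S.Dy)
    + tensor S.l1 S.Rx S.Hy
    + tensor S.l3 S.Hx S.Ry := by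
  simp [Umat, L1_eq, L2_eq, L3_eq, H_eq, alongX_eq, alongY_eq, tensor_mul, tensor_transpose]

theorem Tu_eq : S.Tu = -tensor S.l3 1 (B0 S.Ny * S.Dy) - tensor S.l2ᵀ S.Dx (B0 S.Ny) := by
  simp [Tu, BG, Ty, L2_eq, L3_eq, alongX_eq, alongY_eq, tensor_mul, tensor_transpose, mul_add]
  abel

variable {S}

/-- Discrete integration by parts for the spatial operator of the grid side. -/
theorem H_mul_bulkMat (hx : IsCompatible S.Hx S.Dx S.Dxx S.Sx S.Rx)
    (hy : IsFullyCompatible S.Hy S.Dy S.Dyy S.Ry) :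
    S.H * S.bulkMat = -S.Umat + S.alongX S.Hx * S.Tu := by
  have dx : IsUnit S.Hx.det := hx.isSBP.posDef.det_pos.ne'.isUnit
  have dy : IsUnit S.Hy.det := hy.isSBP.posDef.det_pos.ne'.isUnit
  have sx : S.Hxᵀ = S.Hx := posSemidef_transpose_eq hx.isSBP.posDef.posSemidef
  have sy : S.Hyᵀ = S.Hy := posSemidef_transpose_eq hy.isSBP.posDef.posSemidef
  have bx : S.Hx * S.Dx = Bmat S.Nx - S.Dxᵀ * S.Hx := by
    rw [← hx.isSBP.sbp, Matrix.transpose_mul, sx]; abel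
  have bye : S.Hy * S.Dy = Bmat S.Ny - S.Dyᵀ * S.Hy := by
    rw [← hy.isSBP.sbp, Matrix.transpose_mul, sy]; abel
  have ex : S.Hx * S.Dxx = -(S.Dxᵀ * S.Hx * S.Dx) - S.Rx + Bmat S.Nx * S.Sx := by
    rw [hx.second, Matrix.mul_nonsing_inv_cancel_left _ _ dx]
  have ey : S.Hy * S.Dyy = -(S.Dyᵀ * S.Hy * S.Dy) - S.Ry + Bmat S.Ny * S.Dy := by
    rw [hy.second, Matrix.mul_nonsing_inv_cancel_left _ _ dy]
  have e1 : S.H * (S.L1 * S.alongX S.Dxx) = tensor S.l1 (S.Hx * S.Dxx) S.Hy := by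
    simp [L1_eq, H_eq, alongX_eq, tensor_mul]
  have e2 : S.H * (S.L3 * S.alongY S.Dyy) = tensor S.l3 S.Hx (S.Hy * S.Dyy) := by
    simp [L3_eq, H_eq, alongY_eq, tensor_mul]
  -- The mixed derivative is split between the two directions: the copy with `L2` is integrated by
  -- parts in x and the one with its transpose in y. This makes the result symmetric and yields
  -- precisely the shear parts of the boundary tractions.
  have e3 : S.H * ((S.L2 + S.L2ᵀ) * (S.alongX S.Dx * S.alongY S.Dy))
      = tensor S.l2 (Bmat S.Nx - S.Dxᵀ * S.Hx) (S.Hy * S.Dy)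
        + tensor S.l2ᵀ (S.Hx * S.Dx) (Bmat S.Ny - S.Dyᵀ * S.Hy) := by
    rw [← bx, ← bye]
    simp [L2_eq, H_eq, alongX_eq, alongY_eq, tensor_mul, tensor_transpose, mul_add, add_mul]
  have e4 : S.H * ((S.alongX S.Hx)⁻¹ * S.alongX (Bmat S.Nx) * S.Tx)
      = tensor S.l1 (Bmat S.Nx * S.Sx) S.Hy + tensor S.l2 (Bmat S.Nx) (S.Hy * S.Dy) := by
    simp [Tx, L1_eq, L2_eq, H_eq, alongX_eq, alongY_eq, tensor_mul, tensor_inv, mul_add,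
      Matrix.mul_nonsing_inv_cancel_left _ _ dx, Matrix.mul_assoc]
  have e5 : S.H * ((S.alongY S.Hy)⁻¹ * S.alongY (Bn S.Ny) * S.Ty)
      = tensor S.l3 S.Hx (Bn S.Ny * S.Dy) + tensor S.l2ᵀ (S.Hx * S.Dx) (Bn S.Ny) := by
    simp [Ty, L3_eq, L2_eq, H_eq, alongX_eq, alongY_eq, tensor_mul, tensor_inv, mul_add,
      tensor_transpose, Matrix.mul_nonsing_inv_cancel_left _ _ dy, Matrix.mul_assoc]
  have e6 : S.alongX S.Hx * S.Tu
      = -tensor S.l3 S.Hx (B0 S.Ny * S.Dy) - tensor S.l2ᵀ (S.Hx * S.Dx) (B0 S.Ny) := by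
    rw [Tu_eq]
    simp [alongX_eq, tensor_mul, mul_sub, mul_neg]
  -- `Tx` cancels both lateral boundary terms, and `Ty` the northern half of `Bmat`; what remains
  -- carries -`B0`, which is the traction `Tu` on Γ.
  rw [bulkMat, mul_sub, mul_sub, mul_add, mul_add, e1, e2, e3, e4, e5, e6, Umat_eq, ex, ey]
  simp only [tensor_add_mid, tensor_sub_mid, tensor_neg_mid, tensor_add_right, tensor_sub_right,
    tensor_neg_right, Bmat, sub_mul]
  abel

/-- The two mixed summands are transposes of each other and all the others are symmetric. Symmetry
is what makes the derivative of the elastic form twice the term produced by testing with u_t. -/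
theorem Umat_transpose (hx : IsCompatible S.Hx S.Dx S.Dxx S.Sx S.Rx)
    (hy : IsFullyCompatible S.Hy S.Dy S.Dyy S.Ry) : S.Umatᵀ = S.Umat := by
  have sx : S.Hxᵀ = S.Hx := posSemidef_transpose_eq hx.isSBP.posDef.posSemidef
  have sy : S.Hyᵀ = S.Hy := posSemidef_transpose_eq hy.isSBP.posDef.posSemidef
  have rx : S.Rxᵀ = S.Rx := posSemidef_transpose_eq hx.remainder
  have ry : S.Ryᵀ = S.Ry := posSemidef_transpose_eq hy.remainder
  have t1 : S.l1ᵀ = S.l1 := by ext i j; fin_cases i <;> fin_cases j <;> simp [l1]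
  have t3 : S.l3ᵀ = S.l3 := by ext i j; fin_cases i <;> fin_cases j <;> simp [l3]
  rw [Umat_eq]
  simp only [Matrix.transpose_add, tensor_transpose, Matrix.transpose_mul, sx, sy, rx, ry, t1, t3,
    Matrix.transpose_transpose, Matrix.mul_assoc]
  abel

end CoupledScheme

/-! ### Nonnegativity of the grid-side energy `U2` -/

namespace CoupledScheme

variable {S : CoupledScheme q}

/-- Component of a grid function. -/
def comp (u : S.Grid) (c : Fin 2) : S.GridIdx → ℝ := fun p => u (c, p)

theorem comp_tensor_one (F : Matrix (Fin (S.Nx + 1)) (Fin (S.Nx + 1)) ℝ)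
    (G : Matrix (Fin (S.Ny + 1)) (Fin (S.Ny + 1)) ℝ) (u : S.Grid) (c : Fin 2) :
    comp (S := S) (tensor 1 F G *ᵥ u) c = (F ⊗ₖ G) *ᵥ comp u c :=
  tensor_one_mulVec_apply F G u c

theorem form_tensor (L : Matrix (Fin 2) (Fin 2) ℝ)
    (F : Matrix (Fin (S.Nx + 1)) (Fin (S.Nx + 1)) ℝ)
    (G : Matrix (Fin (S.Ny + 1)) (Fin (S.Ny + 1)) ℝ) (u w : S.Grid) :
    u ⬝ᵥ tensor L F G *ᵥ w =
      L 0 0 * (comp u 0 ⬝ᵥ (F ⊗ₖ G) *ᵥ comp w 0) + L 0 1 * (comp u 0 ⬝ᵥ (F ⊗ₖ G) *ᵥ comp w 1)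
      + (L 1 0 * (comp u 1 ⬝ᵥ (F ⊗ₖ G) *ᵥ comp w 0)
        + L 1 1 * (comp u 1 ⬝ᵥ (F ⊗ₖ G) *ᵥ comp w 1)) := by
  rw [dotProduct_tensor_mulVec]
  simp only [Fin.sum_univ_two]
  rfl

theorem comp_onComponents (L : Matrix (Fin 2) (Fin 2) ℝ) (u : S.Grid) (c : Fin 2) :
    comp (S := S) (tensor L 1 1 *ᵥ u) c = L c 0 • comp u 0 + L c 1 • comp u 1 := by
  funext p
  simp only [comp, mulVec, dotProduct, Fintype.sum_prod_type (f := fun x : Fin 2 × S.GridIdx => _),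
    tensor, Matrix.kroneckerMap_apply (· * ·) L, Matrix.one_kronecker_one, Matrix.one_apply,
    Fin.sum_univ_two]
  simp
  rfl

/-- Partial derivatives of a component of a grid function. -/
def gx (u : S.Grid) (c : Fin 2) : S.GridIdx → ℝ :=
  (S.Dx ⊗ₖ (1 : Matrix (Fin (S.Ny + 1)) (Fin (S.Ny + 1)) ℝ)) *ᵥ comp u c

/-- See `gx`. -/
def gy (u : S.Grid) (c : Fin 2) : S.GridIdx → ℝ :=
  ((1 : Matrix (Fin (S.Nx + 1)) (Fin (S.Nx + 1)) ℝ) ⊗ₖ S.Dy) *ᵥ comp u c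

theorem gx_def (u : S.Grid) (c : Fin 2) :
    (S.Dx ⊗ₖ (1 : Matrix (Fin (S.Ny + 1)) (Fin (S.Ny + 1)) ℝ)) *ᵥ comp u c = gx u c := rfl

theorem gy_def (u : S.Grid) (c : Fin 2) :
    ((1 : Matrix (Fin (S.Nx + 1)) (Fin (S.Nx + 1)) ℝ) ⊗ₖ S.Dy) *ᵥ comp u c = gy u c := rfl

theorem comp_Ty (u : S.Grid) (c : Fin 2) : comp (S := S) (S.Ty *ᵥ u) c
    = S.l3 c 0 • gy u 0 + S.l3 c 1 • gy u 1 + (S.l2 0 c • gx u 0 + S.l2 1 c • gx u 1) := by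
  have h : comp (S := S) (S.Ty *ᵥ u) c
      = comp (S := S) (tensor S.l3 1 1 *ᵥ (tensor 1 1 S.Dy *ᵥ u)) c
        + comp (S := S) (tensor S.l2ᵀ 1 1 *ᵥ (tensor 1 S.Dx 1 *ᵥ u)) c := by
    rw [Ty, L3_eq, L2_eq, alongX_eq, alongY_eq, tensor_transpose, Matrix.transpose_one,
      Matrix.transpose_one, Matrix.add_mulVec, ← Matrix.mulVec_mulVec, ← Matrix.mulVec_mulVec]
    rfl
  rw [h, comp_onComponents, comp_onComponents]
  simp only [comp_tensor_one, gx_def, gy_def, Matrix.transpose_apply]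

/-- The left side is the discrete 2μ|ε|² + λ(div)². Expanding its squares gives the derivative part
of `Umat`, by symmetry of the norm; the difference consists of the remainder terms, which are
nonnegative because Kronecker products of positive semidefinite matrices are and because `l1`, `l3`
are diagonal with positive entries. -/
theorem form_Umat_ge (hx : IsCompatible S.Hx S.Dx S.Dxx S.Sx S.Rx)
    (hy : IsFullyCompatible S.Hy S.Dy S.Dyy S.Ry) (hmu : 0 < S.muu) (hla : 0 < S.lau)
    (u : S.Grid) :
    2 * S.muu * (gx u 0 ⬝ᵥ (S.Hx ⊗ₖ S.Hy) *ᵥ gx u 0)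
      + 2 * S.muu * (gy u 1 ⬝ᵥ (S.Hx ⊗ₖ S.Hy) *ᵥ gy u 1)
      + S.lau * ((gx u 0 + gy u 1) ⬝ᵥ (S.Hx ⊗ₖ S.Hy) *ᵥ (gx u 0 + gy u 1))
      + S.muu * ((gy u 0 + gx u 1) ⬝ᵥ (S.Hx ⊗ₖ S.Hy) *ᵥ (gy u 0 + gx u 1))
      ≤ u ⬝ᵥ S.Umat *ᵥ u := by
  have sx : S.Hxᵀ = S.Hx := posSemidef_transpose_eq hx.isSBP.posDef.posSemidef
  have sy : S.Hyᵀ = S.Hy := posSemidef_transpose_eq hy.isSBP.posDef.posSemidef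
  have sA : (S.Hx ⊗ₖ S.Hy)ᵀ = S.Hx ⊗ₖ S.Hy := by
    rw [← Matrix.kroneckerMap_transpose, sx, sy]
  have k1 : (S.Dxᵀ * S.Hx * S.Dx) ⊗ₖ S.Hy = (S.Dx ⊗ₖ (1 : Matrix (Fin (S.Ny + 1)) _ ℝ))ᵀ
      * (S.Hx ⊗ₖ S.Hy) * (S.Dx ⊗ₖ (1 : Matrix (Fin (S.Ny + 1)) _ ℝ)) := by
    simp [← Matrix.kroneckerMap_transpose, ← Matrix.mul_kronecker_mul]
  have k2 : S.Hx ⊗ₖ (S.Dyᵀ * S.Hy * S.Dy) = ((1 : Matrix (Fin (S.Nx + 1)) _ ℝ) ⊗ₖ S.Dy)ᵀ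
      * (S.Hx ⊗ₖ S.Hy) * ((1 : Matrix (Fin (S.Nx + 1)) _ ℝ) ⊗ₖ S.Dy) := by
    simp [← Matrix.kroneckerMap_transpose, ← Matrix.mul_kronecker_mul]
  have k3 : (S.Dxᵀ * S.Hx) ⊗ₖ (S.Hy * S.Dy) = (S.Dx ⊗ₖ (1 : Matrix (Fin (S.Ny + 1)) _ ℝ))ᵀ
      * (S.Hx ⊗ₖ S.Hy) * ((1 : Matrix (Fin (S.Nx + 1)) _ ℝ) ⊗ₖ S.Dy) := by
    simp [← Matrix.kroneckerMap_transpose, ← Matrix.mul_kronecker_mul]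
  have k4 : (S.Hx * S.Dx) ⊗ₖ (S.Dyᵀ * S.Hy) = ((1 : Matrix (Fin (S.Nx + 1)) _ ℝ) ⊗ₖ S.Dy)ᵀ
      * (S.Hx ⊗ₖ S.Hy) * (S.Dx ⊗ₖ (1 : Matrix (Fin (S.Ny + 1)) _ ℝ)) := by
    simp [← Matrix.kroneckerMap_transpose, ← Matrix.mul_kronecker_mul]
  have rx (c : Fin 2) := posSemidef_dotProduct_nonneg
    (hx.remainder.kronecker hy.isSBP.posDef.posSemidef) (comp u c)
  have ry (c : Fin 2) := posSemidef_dotProduct_nonneg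
    (hx.isSBP.posDef.posSemidef.kronecker hy.remainder) (comp u c)
  rw [Umat_eq]
  simp only [Matrix.add_mulVec, dotProduct_add, form_tensor, k1, k2, k3, k4,
    dotProduct_conj_mulVec]
  simp only [gx_def, gy_def, l1, l2, l3, Matrix.of_apply, Matrix.cons_val', Matrix.cons_val_zero,
    Matrix.cons_val_one, Matrix.transpose_apply, Matrix.cons_val_fin_one, Matrix.mulVec_add,
    add_dotProduct, dotProduct_add]
  have c1 := dotProduct_mulVec_comm_of_transpose_eq sA (gx u 0) (gy u 1)
  have c2 := dotProduct_mulVec_comm_of_transpose_eq sA (gx u 1) (gy u 0)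
  have hc : 0 ≤ 2 * S.muu + S.lau := by positivity
  have p1 := mul_nonneg hc (rx 0)
  have p2 := mul_nonneg hmu.le (rx 1)
  have p3 := mul_nonneg hmu.le (ry 0)
  have p4 := mul_nonneg hc (ry 1)
  rw [c1, c2]
  linarith

/-- The pointwise estimate behind the coupling of energy and traction, for a semi-inner product:
`e` is the strain energy, `k` its boundary weight. -/
theorem energy_add_jump_nonneg {n : Type*} [Fintype n] {A : Matrix n n ℝ} (hA : A.PosSemidef)
    {mu la k β : ℝ} (hmu : 0 < mu) (hla : 0 < la) (hk : 0 < k)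
    (hβ : (2 * mu + la) / (4 * k) ≤ β) (x y s z₁ z₂ : n → ℝ) :
    0 ≤ k * (2 * mu * (x ⬝ᵥ A *ᵥ x) + 2 * mu * (y ⬝ᵥ A *ᵥ y)
          + la * ((x + y) ⬝ᵥ A *ᵥ (x + y)) + mu * (s ⬝ᵥ A *ᵥ s))
      + β * (z₁ ⬝ᵥ A *ᵥ z₁ + z₂ ⬝ᵥ A *ᵥ z₂)
      + (mu * (z₁ ⬝ᵥ A *ᵥ s) + (2 * mu + la) * (z₂ ⬝ᵥ A *ᵥ y) + la * (z₂ ⬝ᵥ A *ᵥ x)) := by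
  have sA := posSemidef_transpose_eq hA
  have hχ : 0 < 2 * mu + la := by positivity
  -- An explicit sum of squares: `q1` absorbs the tangential product z₁·s, `q2` the normal products
  -- of z₂ with y and x. The rest is the surplus penalty `q3`, the part (μ+λ)/(4k) of the penalty
  -- unused by z₁ in `q4`, and in `q5` the coefficient 2μ+λ-λ²/(2μ+λ) = 4μ(μ+λ)/(2μ+λ) left for x.
  -- Only z₂ needs the full threshold for β.
  have q1 := mul_nonneg (mul_nonneg hmu.le hk.le)
    (posSemidef_dotProduct_nonneg hA (s + (1 / (2 * k)) • z₁))
  have q2 := mul_nonneg (mul_nonneg hχ.le hk.le)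
    (posSemidef_dotProduct_nonneg hA ((1 / (2 * k)) • z₂ + y + (la / (2 * mu + la)) • x))
  have q3 := mul_nonneg (sub_nonneg.2 hβ)
    (add_nonneg (posSemidef_dotProduct_nonneg hA z₁) (posSemidef_dotProduct_nonneg hA z₂))
  have q4 : 0 ≤ (mu + la) / (4 * k) * (z₁ ⬝ᵥ A *ᵥ z₁) :=
    mul_nonneg (by positivity) (posSemidef_dotProduct_nonneg hA z₁)
  have q5 : 0 ≤ k * (4 * mu * (mu + la) / (2 * mu + la)) * (x ⬝ᵥ A *ᵥ x) :=
    mul_nonneg (by positivity) (posSemidef_dotProduct_nonneg hA x)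
  have c1 := dotProduct_mulVec_comm_of_transpose_eq sA s z₁
  have c2 := dotProduct_mulVec_comm_of_transpose_eq sA x y
  have c3 := dotProduct_mulVec_comm_of_transpose_eq sA x z₂
  have c4 := dotProduct_mulVec_comm_of_transpose_eq sA y z₂
  simp only [Matrix.mulVec_add, Matrix.mulVec_smul, add_dotProduct, dotProduct_add,
    smul_dotProduct, dotProduct_smul, smul_eq_mul, c1, c2, c3, c4] at q1 q2 q3 q4 q5 ⊢
  refine le_of_le_of_eq (add_nonneg (add_nonneg (add_nonneg (add_nonneg q1 q2) q3) q4) q5) ?_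
  field_simp
  ring

theorem BG_mulVec_projVU (P : Matrix (Fin (S.Nx + 1)) S.GDof ℝ) (g : S.GVec) :
    S.BG *ᵥ (S.projVU P *ᵥ g) = S.projVU P *ᵥ g := by
  rw [Matrix.mulVec_mulVec]
  congr 1
  ext ⟨c, i, j⟩ ⟨c', d⟩
  simp only [BG, alongY, projVU, Matrix.mul_apply, Matrix.kroneckerMap_apply, Matrix.of_apply,
    Fintype.sum_prod_type, Matrix.one_apply, B0, Matrix.single_apply]
  by_cases hj : j = 0
  · subst hj
    simp [Finset.sum_ite_eq]
  · simp [hj, Ne.symm hj]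

theorem B0_mul_self (n : ℕ) : B0 n * B0 n = B0 n := by simp [B0]

theorem B0_transpose (n : ℕ) : (B0 n)ᵀ = B0 n := by simp [B0]

theorem BG_mul_self : S.BG * S.BG = S.BG := by
  simp [BG, alongY_eq, tensor_mul, B0_mul_self]

/-- The density controlled by `form_Umat_ge` in the norm H_x ⊗ H_y is at least k times the same
density in the seminorm H_x ⊗ e₀e₀ᵀ on Γ. There the penalty and the traction term live as well, and
`energy_add_jump_nonneg` applies. -/
theorem U2_nonneg (hG : S.ValidGeometry) (hx : IsCompatible S.Hx S.Dx S.Dxx S.Sx S.Rx)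
    (hy : IsFullyCompatible S.Hy S.Dy S.Dyy S.Ry) (hmu : 0 < S.muu) (hla : 0 < S.lau)
    (hβ : 1 / (4 * sbpBoundaryConst S.Hy S.hu) ≤ S.betav) (hββ : S.betau = S.betav)
    (u : S.Grid) (v : DGSpace S.mesh q) : 0 ≤ S.U2 u v := by
  have sx : S.Hxᵀ = S.Hx := posSemidef_transpose_eq hx.isSBP.posDef.posSemidef
  have hhu : 0 < S.hu := div_pos (sub_pos.2 hG.ab) (by exact_mod_cast hG.nx)
  have hinv : 0 < S.Hy⁻¹ 0 0 := hy.isSBP.posDef.inv.diag_pos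
  -- This is C' h_u; the factor h_u cancels against the 1/h_u of the penalty.
  set k := 1 / S.Hy⁻¹ 0 0 with hk
  have hkpos : 0 < k := by positivity
  have hβ' : (2 * S.muu + S.lau) / (4 * k) ≤ S.chi2 * S.betau / S.hu := by
    have e : (2 * S.muu + S.lau) / (4 * k)
        = S.chi2 * (1 / (4 * sbpBoundaryConst S.Hy S.hu)) / S.hu := by
      simp only [hk, chi2, sbpBoundaryConst]; field_simp
    rw [e, hββ]
    have : 0 < S.chi2 := by unfold chi2; positivity
    gcongr
  have hB0 : (B0 S.Ny).PosSemidef := by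
    refine Matrix.PosSemidef.of_dotProduct_mulVec_nonneg ?_ fun f => ?_
    · rw [Matrix.IsHermitian, Matrix.conjTranspose_eq_transpose_of_trivial, B0_transpose]
    · simp [B0, Matrix.single_mulVec, dotProduct, Function.update_apply, mul_self_nonneg]
  set A := S.Hx ⊗ₖ S.Hy with hA
  set A0 := S.Hx ⊗ₖ B0 S.Ny with hA0
  have psd0 : A0.PosSemidef := hx.isSBP.posDef.posSemidef.kronecker hB0
  have sA0 := posSemidef_transpose_eq psd0
  have dom (f : S.GridIdx → ℝ) : k * (f ⬝ᵥ A0 *ᵥ f) ≤ f ⬝ᵥ A *ᵥ f := by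
    have h := posSemidef_dotProduct_nonneg
      (hx.isSBP.posDef.posSemidef.kronecker (posSemidef_sub_single hy.isSBP.posDef)) f
    have e : S.Hx ⊗ₖ (S.Hy - k • B0 S.Ny) = A - k • A0 := by
      ext i j; simp [hA, hA0]; ring
    rw [← hk, e, Matrix.sub_mulVec, Matrix.smul_mulVec, dotProduct_sub, dotProduct_smul,
      smul_eq_mul] at h
    linarith
  have hU := form_Umat_ge hx hy hmu hla u
  set p := S.projVU S.Pgvu *ᵥ S.traceG v with hp
  -- The projected trace p is supported on Γ, so u - p restricts there to the displacement jump; its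
  -- values off Γ are invisible to `A0`.
  set w : S.Grid := u - p with hw
  have hBp : S.BG *ᵥ p = p := BG_mulVec_projVU _ _
  have hBG : S.BG = tensor 1 1 (B0 S.Ny) := rfl
  have form (f g : S.Grid) : (S.BG *ᵥ f) ⬝ᵥ S.alongX S.Hx *ᵥ (S.BG *ᵥ g)
      = comp f 0 ⬝ᵥ A0 *ᵥ comp g 0 + comp f 1 ⬝ᵥ A0 *ᵥ comp g 1 := by
    rw [← dotProduct_conj_mulVec, hBG, alongX_eq, tensor_transpose, tensor_mul, tensor_mul,
      form_tensor]
    simp [B0_transpose, B0_mul_self, hA0]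
  have hTu : S.Tu *ᵥ u = -(S.BG *ᵥ (S.Ty *ᵥ u)) := by
    rw [Tu, Matrix.neg_mulVec, Matrix.mulVec_mulVec]
  have cT0 : comp (S := S) (S.Ty *ᵥ u) 0 = S.muu • (gy u 0 + gx u 1) := by
    rw [comp_Ty]; simp [l2, l3]
  have cT1 : comp (S := S) (S.Ty *ᵥ u) 1
      = (2 * S.muu + S.lau) • gy u 1 + S.lau • gx u 0 := by
    rw [comp_Ty]; simp [l2, l3]
  have main := energy_add_jump_nonneg psd0 hmu hla hkpos hβ' (gx u 0) (gy u 1)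
    (gy u 0 + gx u 1) (comp w 0) (comp w 1)
  have hcw (c : Fin 2) : comp (S := S) w c = comp u c - comp p c := rfl
  -- The traction term changes sign because `Tu` uses the outward normal (0, -1), whereas `Ty` uses
  -- (0, 1).
  have e0 : S.U2 u v = u ⬝ᵥ S.Umat *ᵥ u
      + S.chi2 * S.betau / S.hu * (comp w 0 ⬝ᵥ A0 *ᵥ comp w 0 + comp w 1 ⬝ᵥ A0 *ᵥ comp w 1)
      + (comp w 0 ⬝ᵥ A0 *ᵥ comp (S := S) (S.Ty *ᵥ u) 0
        + comp w 1 ⬝ᵥ A0 *ᵥ comp (S := S) (S.Ty *ᵥ u) 1) := by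
    rw [U2, ← hp, hTu, ← hBp]
    simp only [Matrix.mulVec_neg, dotProduct_neg, neg_dotProduct, form, hcw, Matrix.mulVec_sub,
      dotProduct_sub, sub_dotProduct]
    have c0 := dotProduct_mulVec_comm_of_transpose_eq sA0 (comp u 0) (comp p 0)
    have c1 := dotProduct_mulVec_comm_of_transpose_eq sA0 (comp u 1) (comp p 1)
    have c2 := dotProduct_mulVec_comm_of_transpose_eq sA0 (comp (S := S) (S.Ty *ᵥ u) 0) (comp p 0)
    have c3 := dotProduct_mulVec_comm_of_transpose_eq sA0 (comp (S := S) (S.Ty *ᵥ u) 1) (comp p 1)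
    rw [c0, c1, c2, c3]
    ring
  rw [e0, cT0, cT1]
  have d1 := mul_le_mul_of_nonneg_left (dom (gx u 0)) (by positivity : 0 ≤ 2 * S.muu)
  have d2 := mul_le_mul_of_nonneg_left (dom (gy u 1)) (by positivity : 0 ≤ 2 * S.muu)
  have d3 := mul_le_mul_of_nonneg_left (dom (gx u 0 + gy u 1)) hla.le
  have d4 := mul_le_mul_of_nonneg_left (dom (gy u 0 + gx u 1)) hmu.le
  simp only [Matrix.mulVec_smul, dotProduct_smul, smul_eq_mul, Matrix.mulVec_add,
    dotProduct_add, add_dotProduct] at main d1 d2 d3 d4 hU ⊢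
  linarith

end CoupledScheme

/-! ### Functions that are polynomial along lines -/

/-- Continuous functions on the plane that are polynomials of degree at most `q` along every
line. -/
structure LinePoly (q : ℕ) (f : ℝ × ℝ → ℝ) : Prop where
  cont : Continuous f
  line : ∀ z d : ℝ × ℝ, ∃ g : Polynomial ℝ, g.natDegree ≤ q ∧ ∀ t : ℝ, f (z + t • d) = g.eval t

namespace LinePoly

theorem add {f g : ℝ × ℝ → ℝ} (hf : LinePoly q f) (hg : LinePoly q g) :
    LinePoly q fun p => f p + g p := by
  refine ⟨hf.cont.add hg.cont, fun z d => ?_⟩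
  obtain ⟨a, ha, ha'⟩ := hf.line z d
  obtain ⟨b, hb, hb'⟩ := hg.line z d
  exact ⟨a + b, Polynomial.natDegree_add_le_of_degree_le ha hb, fun t => by
    simp [ha', hb']⟩

theorem const_mul {f : ℝ × ℝ → ℝ} (hf : LinePoly q f) (c : ℝ) : LinePoly q fun p => c * f p := by
  refine ⟨continuous_const.mul hf.cont, fun z d => ?_⟩
  obtain ⟨a, ha, ha'⟩ := hf.line z d
  exact ⟨Polynomial.C c * a, (Polynomial.natDegree_C_mul_le c a).trans ha, fun t => by
    simp [ha']⟩

theorem sum {ι : Type*} (s : Finset ι) {f : ι → ℝ × ℝ → ℝ} (hf : ∀ i ∈ s, LinePoly q (f i)) :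
    LinePoly q fun p => ∑ i ∈ s, f i p := by
  classical
  induction s using Finset.induction_on with
  | empty => exact ⟨by simpa using continuous_const, fun z d => ⟨0, by simp, by simp⟩⟩
  | insert a s ha ih =>
    simp only [Finset.sum_insert ha]
    exact (hf a (by simp)).add (ih fun i hi => hf i (by simp [hi]))

theorem monomial {i j : ℕ} (h : i + j ≤ q) : LinePoly q fun p => p.1 ^ i * p.2 ^ j := by
  refine ⟨by fun_prop, fun z d => ⟨(Polynomial.C z.1 + Polynomial.C d.1 * Polynomial.X) ^ i
    * (Polynomial.C z.2 + Polynomial.C d.2 * Polynomial.X) ^ j, ?_, fun t => ?_⟩⟩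
  · have hl (a b : ℝ) : (Polynomial.C a + Polynomial.C b * Polynomial.X).natDegree ≤ 1 := by
      compute_degree
    refine Polynomial.natDegree_mul_le.trans (le_trans (Nat.add_le_add ?_ ?_) h)
    · simpa using Polynomial.natDegree_pow_le_of_le i (hl z.1 d.1)
    · simpa using Polynomial.natDegree_pow_le_of_le j (hl z.2 d.2)
  · simp [mul_comm t]

end LinePoly

theorem linePoly_polyVal (c : Mono q → ℝ) : LinePoly q (polyVal c) :=
  LinePoly.sum _ fun m _ => (LinePoly.monomial m.2).const_mul _

/-- The degree bound q is kept although q - 1 would hold for positive q: it suffices for the trace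
inequality and for nodal interpolation, and a constant needs no separate case. -/
theorem linePoly_polyDx (c : Mono q → ℝ) : LinePoly q (polyDx c) :=
  LinePoly.sum _ fun m _ => by
    simpa only [mul_assoc] using ((LinePoly.monomial (q := q) (i := (m.1.1 : ℕ) - 1)
      (j := (m.1.2 : ℕ)) (by have := m.2; omega)).const_mul ((m.1.1 : ℕ) : ℝ)).const_mul (c m)

theorem linePoly_polyDy (c : Mono q → ℝ) : LinePoly q (polyDy c) :=
  LinePoly.sum _ fun m _ => by
    simpa only [mul_left_comm] using ((LinePoly.monomial (q := q) (i := (m.1.1 : ℕ))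
      (j := (m.1.2 : ℕ) - 1) (by have := m.2; omega)).const_mul ((m.1.2 : ℕ) : ℝ)).const_mul (c m)

theorem linePoly_stress (mu la : ℝ) (w : Fin 2 → Mono q → ℝ) (i j : Fin 2) :
    LinePoly q fun p => stress mu la w p i j := by
  have hx (c : Fin 2) := linePoly_polyDx (w c)
  have hy (c : Fin 2) := linePoly_polyDy (w c)
  fin_cases i <;> fin_cases j
  · simpa [stress] using ((hx 0).const_mul _).add ((hy 1).const_mul _)
  · simpa [stress] using ((hy 0).add (hx 1)).const_mul mu
  · simpa [stress] using ((hy 0).add (hx 1)).const_mul mu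
  · simpa [stress] using ((hy 1).const_mul _).add ((hx 0).const_mul _)

theorem linePoly_strain (w : Fin 2 → Mono q → ℝ) (i j : Fin 2) :
    LinePoly q fun p => strain w p i j := by
  have hx (c : Fin 2) := linePoly_polyDx (w c)
  have hy (c : Fin 2) := linePoly_polyDy (w c)
  fin_cases i <;> fin_cases j
  · simpa [strain, jac] using ((hx 0).add (hx 0)).const_mul 2⁻¹
  · simpa [strain, jac] using ((hy 0).add (hx 1)).const_mul 2⁻¹
  · simpa [strain, jac] using ((hx 1).add (hy 0)).const_mul 2⁻¹
  · simpa [strain, jac] using ((hy 1).add (hy 1)).const_mul 2⁻¹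

theorem linePoly_divergence (w : Fin 2 → Mono q → ℝ) : LinePoly q (divergence w) := by
  have := (linePoly_polyDx (w 0)).add (linePoly_polyDy (w 1))
  convert this using 2 with p
  simp [divergence, jac, Matrix.trace_fin_two]

/-! ### Lagrange interpolation along the interface -/

namespace CoupledScheme

variable {S : CoupledScheme q}

/-- Interpolation at q + 1 distinct nodes reproduces polynomials of degree at most q. Traces and
tractions are of this kind along a side, so their nodal vectors represent them exactly, and matrix
terms can be exchanged for line integrals. -/
theorem sum_mul_nodal (hn : Function.Injective S.nodes) {f : ℝ × ℝ → ℝ} (hf : LinePoly q f)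
    (K : Fin S.mesh.card) (i : Fin 3) (s : ℝ) :
    ∑ k, f (S.mesh.sidePt K i (S.nodes k)) * S.nodal k s = f (S.mesh.sidePt K i s) := by
  obtain ⟨g, hg, hg'⟩ := hf.line (S.mesh.sideStart K i) (S.mesh.sideEnd K i - S.mesh.sideStart K i)
  have hd : g.degree < (Finset.univ : Finset (Fin (q + 1))).card := by
    refine lt_of_le_of_lt Polynomial.degree_le_natDegree ?_
    simp only [Finset.card_univ, Fintype.card_fin]
    exact_mod_cast Nat.lt_succ_of_le hg
  have h := Lagrange.eq_interpolate (hn.injOn (s := ↑(Finset.univ : Finset (Fin (q + 1))))) hd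
  have h2 := congrArg (Polynomial.eval s) h
  simp only [Lagrange.interpolate_apply, Polynomial.eval_finsetSum, Polynomial.eval_mul,
    Polynomial.eval_C] at h2
  simp only [TriMesh.sidePt, hg', nodal]
  exact h2.symm

theorem edgeFun_traceG (hn : Function.Injective S.nodes) (v : DGSpace S.mesh q) (e : S.GEdge)
    (s : ℝ) : S.edgeFun (S.traceG v) e s = S.edgeTrace v e s :=
  funext fun c => sum_mul_nodal hn (linePoly_polyVal (v e.1.1 c)) e.1.1 e.1.2 s

theorem edgeFun_Tv (hn : Function.Injective S.nodes) (v : DGSpace S.mesh q) (e : S.GEdge)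
    (s : ℝ) : S.edgeFun (S.Tv v) e s = S.edgeTraction v e s := by
  refine funext fun c => ?_
  have h : LinePoly q fun p => S.tractionG v e.1.1 p c := by
    simpa [tractionG, Matrix.mulVec, dotProduct, Fin.sum_univ_two] using
      linePoly_stress S.muv S.lav (v e.1.1) c 1
  exact sum_mul_nodal hn h e.1.1 e.1.2 s

theorem edgeFun_sub (f g : S.GVec) (e : S.GEdge) (s : ℝ) :
    S.edgeFun (f - g) e s = S.edgeFun f e s - S.edgeFun g e s := by
  funext c
  simp [edgeFun, sub_mul]

theorem continuous_nodal (k : Fin (q + 1)) : Continuous (S.nodal k) :=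
  Polynomial.continuous _

theorem continuous_edgeFun (f : S.GVec) (e : S.GEdge) (c : Fin 2) :
    Continuous fun s => S.edgeFun f e s c :=
  continuous_finsetSum _ fun _ _ => continuous_const.mul (continuous_nodal _)

/-- The mass matrix along the interface represents the `L²` inner product of the edges. -/
theorem dotProduct_MG_mulVec (f g : S.GVec) :
    f ⬝ᵥ S.MG *ᵥ g = S.innerEdges (S.edgeFun f) (S.edgeFun g) := by
  have h1 : S.innerEdges (S.edgeFun f) (S.edgeFun g)
      = ∑ e : S.GEdge, ∑ c, ∑ k, ∑ k', f (c, (e, k)) * (g (c, (e, k')) *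
        S.mesh.sideIntegral e.1.1 e.1.2 fun s => S.nodal k s * S.nodal k' s) := by
    refine Finset.sum_congr rfl fun e _ => ?_
    have hc (k : Fin (q + 1)) : Continuous (S.nodal k) := continuous_nodal k
    simp only [TriMesh.sideIntegral, dotProduct, edgeFun, Finset.sum_mul, Finset.mul_sum]
    rw [intervalIntegral.integral_finsetSum fun c _ => by
      apply Continuous.intervalIntegrable; fun_prop, Finset.mul_sum]
    refine Finset.sum_congr rfl fun c _ => ?_
    rw [intervalIntegral.integral_finsetSum fun c _ => by
      apply Continuous.intervalIntegrable; fun_prop, Finset.mul_sum, Finset.sum_comm]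
    refine Finset.sum_congr rfl fun k _ => ?_
    rw [intervalIntegral.integral_finsetSum fun c _ => by
      apply Continuous.intervalIntegrable; fun_prop, Finset.mul_sum]
    refine Finset.sum_congr rfl fun k' _ => ?_
    have : (fun s => f (c, e, k') * S.nodal k' s * (g (c, e, k) * S.nodal k s))
        = fun s => (f (c, e, k') * g (c, e, k)) * (S.nodal k' s * S.nodal k s) := by
      funext s; ring
    rw [this, intervalIntegral.integral_const_mul]
    ring
  rw [h1, Finset.sum_comm]
  simp only [dotProduct, mulVec, MG, Fintype.sum_prod_type, Matrix.kroneckerMap_apply,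
    Matrix.one_apply, Finset.mul_sum, massG]
  refine Finset.sum_congr rfl fun c _ => Finset.sum_congr rfl fun e _ =>
    Finset.sum_congr rfl fun k _ => ?_
  rw [Finset.sum_eq_single c (fun c' _ hc => by simp [hc.symm]) (by simp),
    Finset.sum_eq_single e (fun e' _ he => by simp [he.symm]) (by simp)]
  refine Finset.sum_congr rfl fun k' _ => ?_
  simp only [if_true, one_mul]
  ring

theorem MG_transpose : S.MGᵀ = S.MG := by
  have : S.massGᵀ = S.massG := by
    ext d d'
    simp only [Matrix.transpose_apply, massG]
    by_cases h : d.1 = d'.1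
    · rw [if_pos h, if_pos h.symm, h]
      simp only [mul_comm]
    · rw [if_neg h, if_neg (Ne.symm h)]
  rw [MG, ← Matrix.kroneckerMap_transpose, this, Matrix.transpose_one]

end CoupledScheme

/-! ### The discrete trace inequality on a triangle -/

/-- On polynomials of bounded degree, the value at `1` is controlled by a weighted `L²` norm. -/
theorem exists_sq_eval_one_le (q : ℕ) : ∃ c : ℝ, 0 < c ∧ ∀ g : Polynomial ℝ, g.natDegree ≤ q →
    g.eval 1 ^ 2 ≤ c * ∫ t in (0 : ℝ)..1, g.eval t ^ 2 * t := by
  let p : (Fin (q + 1) → ℝ) → ℝ → ℝ := fun a t => ∑ i, a i * t ^ (i : ℕ)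
  -- The weight t is, up to a constant, the Jacobian of the map `collapse`.
  let Q : (Fin (q + 1) → ℝ) → ℝ := fun a => ∫ t in (0 : ℝ)..1, p a t ^ 2 * t
  have hcont : Continuous Q :=
    intervalIntegral.continuous_parametric_intervalIntegral_of_continuous' (by fun_prop) 0 1
  have hpos (a : Fin (q + 1) → ℝ) (ha : a ≠ 0) : 0 < Q a := by
    refine intervalIntegral.integral_pos one_pos (by fun_prop)
      (fun t ht => mul_nonneg (sq_nonneg _) ht.1.le) ?_
    by_contra! hno
    let P : Polynomial ℝ := ∑ i : Fin (q + 1), Polynomial.monomial (i : ℕ) (a i)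
    have hP (t : ℝ) : P.eval t = p a t := by
      simp [P, p, Polynomial.eval_finsetSum, Polynomial.eval_monomial]
    have hP0 : P = 0 := by
      refine Polynomial.eq_zero_of_infinite_isRoot P ((Set.Ioc_infinite (zero_lt_one' ℝ)).mono ?_)
      intro t ht
      have h1 := hno t ⟨ht.1.le, ht.2⟩
      have h2 : p a t ^ 2 ≤ 0 := by
        by_contra! h
        exact absurd h1 (not_le.2 (mul_pos h ht.1))
      have h3 : p a t = 0 := by nlinarith [sq_nonneg (p a t)]
      simpa [Polynomial.IsRoot, hP] using h3
    apply ha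
    funext i
    have := congrArg (fun R => Polynomial.coeff R (i : ℕ)) hP0
    simpa [P, Polynomial.coeff_monomial, Fin.val_inj] using this
  -- The positive definite form Q attains a positive minimum on the compact unit sphere of
  -- coefficient vectors; homogeneity extends the bound to all of them.
  obtain ⟨a₀, ha₀, hmin⟩ := (isCompact_sphere (0 : Fin (q + 1) → ℝ) 1).exists_isMinOn
    (NormedSpace.sphere_nonempty.2 zero_le_one) hcont.continuousOn
  have hm : 0 < Q a₀ := hpos a₀ (by
    rintro rfl
    simp at ha₀)
  have hbound (a : Fin (q + 1) → ℝ) : Q a₀ * ‖a‖ ^ 2 ≤ Q a := by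
    by_cases ha : a = 0
    · subst ha
      simp [Q, p]
    have hn : 0 < ‖a‖ := norm_pos_iff.2 ha
    have h := hmin (show ‖a‖⁻¹ • a ∈ Metric.sphere (0 : Fin (q + 1) → ℝ) 1 by
      simp [norm_smul, hn.ne'])
    have e : Q (‖a‖⁻¹ • a) = (‖a‖⁻¹) ^ 2 * Q a := by
      simp only [Q, p]
      rw [← intervalIntegral.integral_const_mul]
      congr 1
      funext t
      simp only [Pi.smul_apply, smul_eq_mul, mul_assoc, ← Finset.mul_sum]
      ring
    simp only [Set.mem_ofPred_eq, e] at h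
    calc Q a₀ * ‖a‖ ^ 2 ≤ ‖a‖⁻¹ ^ 2 * Q a * ‖a‖ ^ 2 := by gcongr
      _ = Q a := by field_simp
  -- The value at 1 is the sum of q + 1 coefficients, each bounded by the sup norm.
  refine ⟨((q : ℝ) + 1) ^ 2 / Q a₀, by positivity, fun g hg => ?_⟩
  let a : Fin (q + 1) → ℝ := fun i => g.coeff i
  have hga (t : ℝ) : g.eval t = p a t := by
    rw [Polynomial.eval_eq_sum_range' (Nat.lt_succ_of_le hg), Finset.sum_range]
  have h1 : |g.eval 1| ≤ (q + 1) * ‖a‖ := by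
    rw [hga]
    calc |∑ i, a i * 1 ^ (i : ℕ)| ≤ ∑ i, |a i * 1 ^ (i : ℕ)| := Finset.abs_sum_le_sum_abs _ _
      _ ≤ ∑ _i : Fin (q + 1), ‖a‖ := Finset.sum_le_sum fun i _ => by
          simpa using norm_le_pi_norm a i
      _ = (q + 1) * ‖a‖ := by simp
  have h2 : ∫ t in (0 : ℝ)..1, g.eval t ^ 2 * t = Q a := by simp only [Q, hga]
  rw [h2, ← sq_abs, div_mul_eq_mul_div, le_div_iff₀ hm]
  calc |g.eval 1| ^ 2 * Q a₀ ≤ ((q + 1) * ‖a‖) ^ 2 * Q a₀ := by gcongr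
    _ = (q + 1) ^ 2 * (Q a₀ * ‖a‖ ^ 2) := by ring
    _ ≤ (q + 1) ^ 2 * Q a := by gcongr; exact hbound a

/-- Parametrization of the triangle `Z A B` by the unit square that collapses one side to `Z`. -/
def collapse (Z A B : ℝ × ℝ) (p : ℝ × ℝ) : ℝ × ℝ := Z + p.2 • (A + p.1 • (B - A) - Z)

theorem hasFDerivAt_collapse (Z A B p : ℝ × ℝ) : HasFDerivAt (collapse Z A B)
    ((Matrix.toLin (.finTwoProd ℝ) (.finTwoProd ℝ)
      !![p.2 * (B.1 - A.1), A.1 + p.1 * (B.1 - A.1) - Z.1;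
        p.2 * (B.2 - A.2), A.2 + p.1 * (B.2 - A.2) - Z.2]).toContinuousLinearMap) p := by
  rw [Matrix.toLin_finTwoProd_toContinuousLinearMap]
  have h (z a b : ℝ) : HasFDerivAt (fun r : ℝ × ℝ => z + r.2 * (a + r.1 * (b - a) - z))
      ((p.2 * (b - a)) • ContinuousLinearMap.fst ℝ ℝ ℝ
        + (a + p.1 * (b - a) - z) • ContinuousLinearMap.snd ℝ ℝ ℝ) p := by
    have h1 : HasFDerivAt (fun r : ℝ × ℝ => r.1) (ContinuousLinearMap.fst ℝ ℝ ℝ) p := hasFDerivAt_fst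
    have h2 : HasFDerivAt (fun r : ℝ × ℝ => r.2) (ContinuousLinearMap.snd ℝ ℝ ℝ) p := hasFDerivAt_snd
    refine ((h2.mul (((h1.mul_const (b - a)).const_add a).sub_const z)).const_add z).congr_fderiv ?_
    ext <;> simp
  exact (h Z.1 A.1 B.1).prodMk (h Z.2 A.2 B.2)

/-- Each point of the side AB is the end t = 1 of a segment from Z along which f is a polynomial of
degree at most q. The one-dimensional bound on that segment is integrated over the side; the
Jacobian tJ of `collapse` turns the weighted double integral into an area integral. The image need
only lie in K. -/
theorem collapse_trace_le {c : ℝ} (hc : 0 < c) (hc' : ∀ g : Polynomial ℝ, g.natDegree ≤ q →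
      g.eval 1 ^ 2 ≤ c * ∫ t in (0 : ℝ)..1, g.eval t ^ 2 * t)
    {f : ℝ × ℝ → ℝ} (hf : LinePoly q f) {Z A B : ℝ × ℝ}
    (hJ : 0 < (A.1 - Z.1) * (B.2 - Z.2) - (A.2 - Z.2) * (B.1 - Z.1))
    {K : Set (ℝ × ℝ)} (hK : Convex ℝ K) (hK' : IsCompact K) (hZ : Z ∈ K) (hA : A ∈ K)
    (hB : B ∈ K) :
    ((A.1 - Z.1) * (B.2 - Z.2) - (A.2 - Z.2) * (B.1 - Z.1))
      * ∫ s in (0 : ℝ)..1, f (A + s • (B - A)) ^ 2 ≤ c * ∫ p in K, f p ^ 2 := by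
  set J := (A.1 - Z.1) * (B.2 - Z.2) - (A.2 - Z.2) * (B.1 - Z.1) with hJdef
  -- The edge t = 0, which is collapsed to Z, is left out to keep the map injective.
  let U : Set (ℝ × ℝ) := Set.Ioc 0 1 ×ˢ Set.Ioc 0 1
  have hfc := hf.cont
  have hcc : Continuous (collapse Z A B) := by unfold collapse; fun_prop
  have hinj : Set.InjOn (collapse Z A B) U := by
    rintro ⟨s, t⟩ ⟨-, ht⟩ ⟨s', t'⟩ ⟨-, ht'⟩ h
    have h1 := congrArg Prod.fst h
    have h2 := congrArg Prod.snd h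
    simp only [collapse, Prod.fst_add, Prod.smul_fst, Prod.fst_sub, Prod.snd_add, Prod.smul_snd,
      Prod.snd_sub, smul_eq_mul, add_right_inj] at h1 h2
    -- The difference of the two images is a combination of A - Z and B - A. Taking determinants
    -- with B - A and with A - Z isolates its coefficients t - t' and ts - t's'.
    have e1 : (t - t') * J = 0 := by
      rw [hJdef]; linear_combination (B.2 - A.2) * h1 - (B.1 - A.1) * h2
    have e2 : (t * s - t' * s') * J = 0 := by
      rw [hJdef]; linear_combination (A.1 - Z.1) * h2 - (A.2 - Z.2) * h1
    have ht2 : t = t' := sub_eq_zero.1 ((mul_eq_zero.1 e1).resolve_right hJ.ne')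
    subst ht2
    have hs2 := sub_eq_zero.1 ((mul_eq_zero.1 e2).resolve_right hJ.ne')
    have : s = s' := mul_left_cancel₀ (ne_of_gt ht.1) hs2
    rw [this]
  have hsub : collapse Z A B '' U ⊆ K := by
    rintro _ ⟨⟨s, t⟩, ⟨hs, ht⟩, rfl⟩
    have hE : A + s • (B - A) ∈ K := hK.add_smul_sub_mem hA hB ⟨hs.1.le, hs.2⟩
    exact hK.add_smul_sub_mem hZ hE ⟨ht.1.le, ht.2⟩
  have hcv := MeasureTheory.integral_image_eq_integral_abs_det_fderiv_smul MeasureTheory.volume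
    (measurableSet_Ioc.prod measurableSet_Ioc : MeasurableSet U)
    (fun p _ => (hasFDerivAt_collapse Z A B p).hasFDerivWithinAt) hinj (fun p => f p ^ 2)
  have hint : ∫ p in collapse Z A B '' U, f p ^ 2 ≤ ∫ p in K, f p ^ 2 :=
    MeasureTheory.setIntegral_mono_set
      ((hfc.pow 2).continuousOn.integrableOn_compact hK')
      (Filter.Eventually.of_forall fun p => sq_nonneg _) hsub.eventuallyLE
  have hU : ∫ p in collapse Z A B '' U, f p ^ 2
      = ∫ s in (0 : ℝ)..1, ∫ t in (0 : ℝ)..1, J * (f (collapse Z A B (s, t)) ^ 2 * t) := by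
    rw [hcv, MeasureTheory.setIntegral_congr_fun
      (g := fun p : ℝ × ℝ => J * (f (collapse Z A B p) ^ 2 * p.2))
      (measurableSet_Ioc.prod measurableSet_Ioc)]
    · rw [intervalIntegral.integral_of_le zero_le_one]
      simp only [intervalIntegral.integral_of_le (zero_le_one' ℝ)]
      refine MeasureTheory.setIntegral_prod _ ?_
      have hcont : Continuous fun p : ℝ × ℝ => J * (f (collapse Z A B p) ^ 2 * p.2) := by fun_prop
      exact (hcont.continuousOn.integrableOn_compact
        (isCompact_Icc.prod isCompact_Icc : IsCompact (Set.Icc (0 : ℝ) 1 ×ˢ Set.Icc (0 : ℝ) 1))).mono_set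
        (Set.prod_mono Set.Ioc_subset_Icc_self Set.Ioc_subset_Icc_self)
    · rintro ⟨s, t⟩ ⟨-, ht⟩
      have hdet : (t * (B.1 - A.1)) * (A.2 + s * (B.2 - A.2) - Z.2)
          - (A.1 + s * (B.1 - A.1) - Z.1) * (t * (B.2 - A.2)) = -(t * J) := by
        rw [hJdef]; ring
      simp only [LinearMap.det_toContinuousLinearMap, LinearMap.det_toLin,
        Matrix.det_fin_two_of, hdet, abs_neg, smul_eq_mul]
      rw [abs_of_pos (mul_pos ht.1 hJ)]
      ring
  have hpt (s : ℝ) : J * f (A + s • (B - A)) ^ 2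
      ≤ c * ∫ t in (0 : ℝ)..1, J * (f (collapse Z A B (s, t)) ^ 2 * t) := by
    obtain ⟨g, hg, hg'⟩ := hf.line Z (A + s • (B - A) - Z)
    have h := hc' g hg
    rw [← hg' 1, one_smul, add_sub_cancel] at h
    simp only [collapse, hg', intervalIntegral.integral_const_mul]
    nlinarith
  calc J * ∫ s in (0 : ℝ)..1, f (A + s • (B - A)) ^ 2
      = ∫ s in (0 : ℝ)..1, J * f (A + s • (B - A)) ^ 2 := by
        rw [intervalIntegral.integral_const_mul]
    _ ≤ ∫ s in (0 : ℝ)..1, c * ∫ t in (0 : ℝ)..1, J * (f (collapse Z A B (s, t)) ^ 2 * t) := by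
        refine intervalIntegral.integral_mono_on zero_le_one ?_ ?_ fun s _ => hpt s
        · apply Continuous.intervalIntegrable
          fun_prop
        · apply Continuous.intervalIntegrable
          exact continuous_const.mul
            (intervalIntegral.continuous_parametric_intervalIntegral_of_continuous' (by fun_prop) 0 1)
    _ = c * ∫ p in collapse Z A B '' U, f p ^ 2 := by
        rw [hU, intervalIntegral.integral_const_mul]
    _ ≤ c * ∫ p in K, f p ^ 2 := by gcongr

namespace TriMesh

variable {M : TriMesh}

/-! ### Elementary geometry of a mesh -/

theorem area_pos (K : Fin M.card) : 0 < M.area K := by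
  have := M.ccw K
  unfold area; linarith

/-- Twice the area, computed from any side and its opposite vertex. -/
theorem two_mul_area_eq (K : Fin M.card) (i : Fin 3) :
    ((M.sideStart K i).1 - (M.vert K i).1) * ((M.sideEnd K i).2 - (M.vert K i).2)
      - ((M.sideStart K i).2 - (M.vert K i).2) * ((M.sideEnd K i).1 - (M.vert K i).1)
      = 2 * M.area K := by
  unfold area sideStart sideEnd
  fin_cases i <;> simp <;> ring

theorem range_vert (K : Fin M.card) (i : Fin 3) :
    Set.range (M.vert K) = {M.vert K i, M.sideStart K i, M.sideEnd K i} := by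
  ext p
  simp only [Set.mem_range, Set.mem_insert_iff, Set.mem_singleton_iff,
    sideStart, sideEnd]
  constructor
  · rintro ⟨j, rfl⟩
    fin_cases i <;> fin_cases j <;> simp
  · rintro (rfl | rfl | rfl) <;> exact ⟨_, rfl⟩

theorem isCompact_tri (K : Fin M.card) : IsCompact (M.tri K) :=
  (Set.finite_range _).isCompact_convexHull ℝ

theorem convex_tri (K : Fin M.card) : Convex ℝ (M.tri K) := convex_convexHull ℝ _

theorem vert_mem_tri (K : Fin M.card) (i : Fin 3) : M.vert K i ∈ M.tri K :=
  subset_convexHull ℝ _ ⟨i, rfl⟩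

theorem sideLen_nonneg (K : Fin M.card) (i : Fin 3) : 0 ≤ M.sideLen K i := Real.sqrt_nonneg _

theorem sideLen_pos (K : Fin M.card) (i : Fin 3) : 0 < M.sideLen K i := by
  refine Real.sqrt_pos.2 ?_
  by_contra! h
  have h1 : (M.sideEnd K i).1 - (M.sideStart K i).1 = 0 := by
    nlinarith [sq_nonneg ((M.sideEnd K i).1 - (M.sideStart K i).1),
      sq_nonneg ((M.sideEnd K i).2 - (M.sideStart K i).2)]
  have h2 : (M.sideEnd K i).2 - (M.sideStart K i).2 = 0 := by
    nlinarith [sq_nonneg ((M.sideEnd K i).1 - (M.sideStart K i).1),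
      sq_nonneg ((M.sideEnd K i).2 - (M.sideStart K i).2)]
  have h3 := two_mul_area_eq K i
  have h4 := area_pos K
  rw [sub_eq_zero.1 h1, sub_eq_zero.1 h2] at h3
  nlinarith

theorem sideLen_le_perimeter (K : Fin M.card) (i : Fin 3) :
    M.sideLen K i ≤ M.sideLen K 0 + M.sideLen K 1 + M.sideLen K 2 := by
  have h0 := sideLen_nonneg K 0
  have h1 := sideLen_nonneg K 1
  have h2 := sideLen_nonneg K 2
  fin_cases i <;> simp <;> linarith

theorem inradius_pos (K : Fin M.card) : 0 < M.inradius K := by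
  have h0 := sideLen_pos K 0
  have h1 := sideLen_pos K 1
  have h2 := sideLen_pos K 2
  have := area_pos K
  unfold inradius; positivity

theorem hK_pos (K : Fin M.card) : 0 < M.hK K := lt_max_of_lt_left (sideLen_pos K 0)

theorem hmin_le (K : Fin M.card) : M.hmin ≤ M.hK K := ciInf_le (Set.finite_range _).bddBelow K

theorem hmin_pos [Nonempty (Fin M.card)] : 0 < M.hmin := by
  obtain ⟨K, hK⟩ := exists_eq_ciInf_of_finite (f := M.hK)
  rw [hmin, ← hK]
  exact hK_pos K

/-- The discrete trace inequality, with the constant of `exists_sq_eval_one_le`. -/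
theorem sideIntegral_sq_le {c : ℝ} (hc : 0 < c) (hc' : ∀ g : Polynomial ℝ, g.natDegree ≤ q →
      g.eval 1 ^ 2 ≤ c * ∫ t in (0 : ℝ)..1, g.eval t ^ 2 * t)
    {κ : ℝ} (hκ : 0 ≤ κ) (hM : M.ShapeRegular κ) {f : ℝ × ℝ → ℝ} (hf : LinePoly q f)
    (K : Fin M.card) (i : Fin 3) :
    M.hmin * M.sideIntegral K i (fun s => f (M.sidePt K i s) ^ 2)
      ≤ c * κ * ∫ p in M.tri K, f p ^ 2 := by
  have hJ := two_mul_area_eq K i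
  have ha := area_pos K
  have h := collapse_trace_le (Z := M.vert K i) (A := M.sideStart K i) (B := M.sideEnd K i)
    hc hc' hf (by rw [hJ]; linarith) (convex_tri K) (isCompact_tri K)
    (vert_mem_tri K i) (vert_mem_tri K (i + 1)) (vert_mem_tri K (i + 2))
  rw [hJ] at h
  have h0 := sideLen_pos K 0
  have h1 := sideLen_pos K 1
  have h2 := sideLen_pos K 2
  set p := M.sideLen K 0 + M.sideLen K 1 + M.sideLen K 2 with hp
  -- Inradius times perimeter is twice the area; this is the only place where shape regularity
  -- enters the estimate.
  have hlen : M.hmin * M.sideLen K i ≤ κ * (2 * M.area K) := by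
    calc M.hmin * M.sideLen K i ≤ κ * M.inradius K * M.sideLen K i :=
          mul_le_mul_of_nonneg_right ((hmin_le K).trans (hM K)) (sideLen_nonneg K i)
      _ ≤ κ * M.inradius K * p := by
          have := (inradius_pos K).le
          gcongr
          exact sideLen_le_perimeter K i
      _ = κ * (2 * M.area K) := by
          rw [inradius, ← hp]
          have hp0 : p ≠ 0 := by positivity
          field_simp
  have hI : 0 ≤ ∫ s in (0 : ℝ)..1, f (M.sidePt K i s) ^ 2 :=
    intervalIntegral.integral_nonneg zero_le_one fun s _ => sq_nonneg _
  calc M.hmin * M.sideIntegral K i (fun s => f (M.sidePt K i s) ^ 2)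
      = M.hmin * M.sideLen K i * ∫ s in (0 : ℝ)..1, f (M.sidePt K i s) ^ 2 := by
        rw [sideIntegral, mul_assoc]
    _ ≤ κ * (2 * M.area K) * ∫ s in (0 : ℝ)..1, f (M.sidePt K i s) ^ 2 := by gcongr
    _ = κ * (2 * M.area K * ∫ s in (0 : ℝ)..1, f (M.sidePt K i s) ^ 2) := by ring
    _ ≤ κ * (c * ∫ p in M.tri K, f p ^ 2) := mul_le_mul_of_nonneg_left h hκ
    _ = _ := by ring

/-! ### Each side belongs to at most one interior edge -/

theorem vert_injective (K : Fin M.card) : Function.Injective (M.vert K) := by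
  intro a b h
  have hc := M.ccw K
  by_contra hab
  fin_cases a <;> fin_cases b <;> simp_all <;> linarith

/-- A directed side determines its triangle: two triangles on the same side of a common side would
overlap. -/
theorem side_unique {K L : Fin M.card} {i j : Fin 3} (hs : M.sideStart K i = M.sideStart L j)
    (he : M.sideEnd K i = M.sideEnd L j) : (K, i) = (L, j) := by
  have hKL : K = L := by
    by_contra hne
    set P := M.sideStart K i with hP
    set Q := M.sideEnd K i with hQ
    set R := M.vert K i with hR
    set R' := M.vert L j with hR'
    -- Twice the signed area of the triangle PQX: zero on the line PQ and positive at both apexes.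
    -- By conformity the two triangles may meet only on that line.
    let f : ℝ × ℝ → ℝ := fun X => (P.1 - X.1) * (Q.2 - X.2) - (P.2 - X.2) * (Q.1 - X.1)
    have fR : 0 < f R := by
      have := two_mul_area_eq K i
      have := area_pos K
      simp only [f]; linarith
    have fR' : 0 < f R' := by
      have := two_mul_area_eq L j
      rw [← hs, ← he] at this
      have := area_pos L
      simp only [f]; linarith
    have fP : f P = 0 := by simp [f]
    have fQ : f Q = 0 := by simp [f]
    have hrK : Set.range (M.vert K) = {R, P, Q} := range_vert K i
    have hrL : Set.range (M.vert L) = {R', P, Q} := by rw [hs, he]; exact range_vert L j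
    have hRR : R ≠ R' := by
      intro h
      exact hne (M.distinct (show Set.range (M.vert K) = Set.range (M.vert L) by
        rw [hrK, hrL, h]))
    have hcommon : convexHull ℝ (Set.range (M.vert K) ∩ Set.range (M.vert L)) ⊆ {X | f X = 0} := by
      refine convexHull_min ?_ ?_
      · rintro X ⟨h1, h2⟩
        rw [hrK] at h1
        rw [hrL] at h2
        rcases h1 with rfl | rfl | rfl
        · rcases h2 with h2 | h2 | h2
          · exact absurd h2 hRR
          · rw [h2]; exact fP
          · rw [h2]; exact fQ
        · exact fP
        · exact fQ
      · intro X hX Y hY a b _ _ hab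
        simp only [Set.mem_ofPred_eq, f, Prod.fst_add, Prod.snd_add, Prod.smul_fst, Prod.smul_snd,
          smul_eq_mul] at hX hY ⊢
        obtain rfl : b = 1 - a := by linarith
        linear_combination a * hX + (1 - a) * hY
    -- The coordinates of R' in the affine frame P, Q - P, R - P, by Cramer's rule.
    set x := ((R'.1 - P.1) * (R.2 - P.2) - (R'.2 - P.2) * (R.1 - P.1)) / f R with hx
    set y := f R' / f R with hy
    have hy0 : 0 < y := div_pos fR' fR
    -- A step of size ε from the midpoint of PQ towards R' stays in L. For this ε its barycentric
    -- coordinates in K are nonnegative too, so X lies in both triangles, but off the line PQ.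
    set ε := 1 / (2 * (|x| + 1 + y)) with hε
    have hε0 : 0 < ε := by positivity
    have hε1 : ε * (|x| + 1 + y) = 1 / 2 := by rw [hε]; field_simp
    have hxa := neg_abs_le x
    have hxb := le_abs_self x
    have hx0 := abs_nonneg x
    set X : ℝ × ℝ := (1 / 2 + ε * (x - 1 / 2)) • Q + (ε * y) • R
      + (1 - (1 / 2 + ε * (x - 1 / 2)) - ε * y) • P with hX
    have X1 : X.1 = (1 - ε) * (1 / 2 * P.1 + 1 / 2 * Q.1) + ε * R'.1 := by
      have hfR : f R ≠ 0 := fR.ne'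
      simp only [hX, Prod.fst_add, Prod.smul_fst, smul_eq_mul, hx, hy]
      field_simp
      simp only [f]
      ring
    have X2 : X.2 = (1 - ε) * (1 / 2 * P.2 + 1 / 2 * Q.2) + ε * R'.2 := by
      have hfR : f R ≠ 0 := fR.ne'
      simp only [hX, Prod.snd_add, Prod.smul_snd, smul_eq_mul, hx, hy]
      field_simp
      simp only [f]
      ring
    have hXK : X ∈ M.tri K := by
      have h := (convex_tri K).sum_mem (t := Finset.univ)
        (w := ![1 / 2 + ε * (x - 1 / 2), ε * y, 1 - (1 / 2 + ε * (x - 1 / 2)) - ε * y])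
        (z := ![Q, R, P]) (by
          intro k _
          fin_cases k
          · simp; nlinarith
          · simp; positivity
          · simp; nlinarith) (by simp [Fin.sum_univ_three]) (by
          intro k _
          fin_cases k
          · exact vert_mem_tri K _
          · exact vert_mem_tri K _
          · exact vert_mem_tri K _)
      convert h using 1
      simp [hX, Fin.sum_univ_three]
    have hXL : X ∈ M.tri L := by
      have h := (convex_tri L).sum_mem (t := Finset.univ)
        (w := ![(1 - ε) * (1 / 2), (1 - ε) * (1 / 2), ε])
        (z := ![P, Q, R']) (by
          intro k _
          fin_cases k
          · simp; nlinarith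
          · simp; nlinarith
          · simp; positivity) (by simp [Fin.sum_univ_three]; ring) (by
          intro k _
          fin_cases k
          · simp only [hs]; exact vert_mem_tri L _
          · simp only [he]; exact vert_mem_tri L _
          · exact vert_mem_tri L _)
      convert h using 1
      ext
      · rw [X1]; simp [Fin.sum_univ_three]; ring
      · rw [X2]; simp [Fin.sum_univ_three]; ring
    have h0 : f X = 0 := hcommon (by rw [← M.conforming]; exact ⟨hXK, hXL⟩)
    have h1 : f X = ε * f R' := by
      simp only [f, X1, X2]; ring
    exact absurd h0 (by rw [h1]; positivity)
  subst hKL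
  have : i + 1 = j + 1 := vert_injective K hs
  rw [add_right_cancel this]

theorem mem_interiorEdges {e : (Fin M.card × Fin 3) × (Fin M.card × Fin 3)} :
    e ∈ M.interiorEdges ↔ e.1.1 < e.2.1
      ∧ M.sideStart e.1.1 e.1.2 = M.sideEnd e.2.1 e.2.2
      ∧ M.sideEnd e.1.1 e.1.2 = M.sideStart e.2.1 e.2.2 := by
  simp [interiorEdges]

/-- By `side_unique` the reversed side determines the neighbour, so an interior edge is determined
by its first side and no term is counted twice. -/
theorem sum_interiorEdges_fst_le {G : Fin M.card × Fin 3 → ℝ} (hG : ∀ e, 0 ≤ G e) :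
    ∑ e ∈ M.interiorEdges, G e.1 ≤ ∑ K, ∑ i, G (K, i) := by
  classical
  rw [← Fintype.sum_prod_type', ← Finset.sum_image (g := Prod.fst) (f := G)]
  · exact Finset.sum_le_sum_of_subset_of_nonneg (Finset.subset_univ _) fun e _ _ => hG e
  · rintro ⟨⟨K, i⟩, ⟨L, j⟩⟩ he ⟨⟨K', i'⟩, ⟨L', j'⟩⟩ he' h
    have he := mem_interiorEdges.1 (Finset.mem_coe.1 he)
    have he' := mem_interiorEdges.1 (Finset.mem_coe.1 he')
    obtain ⟨rfl, rfl⟩ := Prod.mk.inj h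
    have := side_unique (he.2.2.symm.trans he'.2.2) (he.2.1.symm.trans he'.2.1)
    rw [this]

theorem sum_interiorEdges_snd_le {G : Fin M.card × Fin 3 → ℝ} (hG : ∀ e, 0 ≤ G e) :
    ∑ e ∈ M.interiorEdges, G e.2 ≤ ∑ K, ∑ i, G (K, i) := by
  classical
  rw [← Fintype.sum_prod_type', ← Finset.sum_image (g := Prod.snd) (f := G)]
  · exact Finset.sum_le_sum_of_subset_of_nonneg (Finset.subset_univ _) fun e _ _ => hG e
  · rintro ⟨⟨K, i⟩, ⟨L, j⟩⟩ he ⟨⟨K', i'⟩, ⟨L', j'⟩⟩ he' h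
    have he := mem_interiorEdges.1 (Finset.mem_coe.1 he)
    have he' := mem_interiorEdges.1 (Finset.mem_coe.1 he')
    obtain ⟨rfl, rfl⟩ := Prod.mk.inj h
    have := side_unique (he.2.1.trans he'.2.1.symm) (he.2.2.trans he'.2.2.symm)
    rw [this]

theorem sum_ifaceSide_le {a b y₀ : ℝ} {G : Fin M.card × Fin 3 → ℝ} (hG : ∀ e, 0 ≤ G e) :
    ∑ e : M.IfaceSide a b y₀, G e.1 ≤ ∑ K, ∑ i, G (K, i) := by
  classical
  rw [← Fintype.sum_prod_type', ← Finset.sum_image (g := Subtype.val) (f := G)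
    Subtype.val_injective.injOn]
  exact Finset.sum_le_sum_of_subset_of_nonneg (Finset.subset_univ _) fun e _ _ => hG e

end TriMesh

/-! ### Elastic energy density and traction -/

/-- The density `2 μ |ε(w)|² + λ (∇·w)²`. -/
def energyDensity (mu la : ℝ) (w : Fin 2 → Mono q → ℝ) (p : ℝ × ℝ) : ℝ :=
  2 * mu * contract (strain w p) (strain w p) + la * (divergence w p * divergence w p)

theorem energyDensity_eq (mu la : ℝ) (w : Fin 2 → Mono q → ℝ) (p : ℝ × ℝ) :
    energyDensity mu la w p = 2 * mu * strain w p 0 0 ^ 2 + 4 * mu * strain w p 0 1 ^ 2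
      + 2 * mu * strain w p 1 1 ^ 2 + la * divergence w p ^ 2 := by
  simp [energyDensity, contract, strain, jac, Fin.sum_univ_two]
  ring

theorem energyDensity_nonneg {mu la : ℝ} (hmu : 0 < mu) (hla : 0 < la)
    (w : Fin 2 → Mono q → ℝ) (p : ℝ × ℝ) : 0 ≤ energyDensity mu la w p := by
  rw [energyDensity_eq]; positivity

theorem continuous_energyDensity (mu la : ℝ) (w : Fin 2 → Mono q → ℝ) :
    Continuous (energyDensity mu la w) := by
  have h0 := (linePoly_strain w 0 0).cont
  have h1 := (linePoly_strain w 0 1).cont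
  have h2 := (linePoly_strain w 1 1).cont
  have h3 := (linePoly_divergence w).cont
  have : energyDensity mu la w = fun p => 2 * mu * strain w p 0 0 ^ 2 + 4 * mu * strain w p 0 1 ^ 2
      + 2 * mu * strain w p 1 1 ^ 2 + la * divergence w p ^ 2 := funext (energyDensity_eq mu la w)
  rw [this]
  fun_prop

/-- Tractions are bounded by the energy density. -/
theorem traction_sq_le {mu la : ℝ} (hmu : 0 < mu) (hla : 0 < la) (w : Fin 2 → Mono q → ℝ)
    (p : ℝ × ℝ) {n : Fin 2 → ℝ} (hn : n 0 ^ 2 + n 1 ^ 2 = 1) :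
    (stress mu la w p *ᵥ n) ⬝ᵥ (stress mu la w p *ᵥ n)
      ≤ 2 * (2 * mu + la) * energyDensity mu la w p := by
  rw [energyDensity_eq]
  simp only [stress, strain, jac, divergence, Matrix.trace_fin_two, Matrix.mulVec, dotProduct,
    Fin.sum_univ_two, Matrix.of_apply, Matrix.cons_val', Matrix.cons_val_zero, Matrix.cons_val_one,
    Matrix.cons_val_fin_one, Matrix.smul_apply, Matrix.add_apply, Matrix.transpose_apply,
    smul_eq_mul]
  generalize polyDx (w 0) p = a
  generalize polyDy (w 0) p = b
  generalize polyDx (w 1) p = c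
  generalize polyDy (w 1) p = d
  -- Since n is a unit vector, |σn| is at most the Frobenius norm of σ. The factor 2(2μ+λ) is
  -- tailored to cancel against the factor χ₁ of the penalties.
  have cs (x y : ℝ) : (x * n 0 + y * n 1) * (x * n 0 + y * n 1) ≤ x ^ 2 + y ^ 2 := by
    nlinarith [sq_nonneg (x * n 1 - y * n 0)]
  refine (add_le_add (cs _ _) (cs _ _)).trans ?_
  have e : 2 * (2 * mu + la) * (2 * mu * (1 / 2 * (a + a)) ^ 2 + 4 * mu * (1 / 2 * (b + c)) ^ 2
      + 2 * mu * (1 / 2 * (d + d)) ^ 2 + la * (a + d) ^ 2)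
      - (((2 * mu + la) * a + la * d) ^ 2 + (mu * (b + c)) ^ 2
        + ((mu * (b + c)) ^ 2 + ((2 * mu + la) * d + la * a) ^ 2))
      = 4 * mu ^ 2 * (a ^ 2 + d ^ 2) + 2 * mu ^ 2 * (b + c) ^ 2
        + 4 * mu * la * (a ^ 2 + d ^ 2) + 2 * mu * la * (b + c) ^ 2 := by
    ring
  have : 0 ≤ 4 * mu ^ 2 * (a ^ 2 + d ^ 2) + 2 * mu ^ 2 * (b + c) ^ 2
        + 4 * mu * la * (a ^ 2 + d ^ 2) + 2 * mu * la * (b + c) ^ 2 := by positivity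
  linarith

theorem dotProduct_half_smul_add_le (a b : Fin 2 → ℝ) :
    ((1 / 2 : ℝ) • (a + b)) ⬝ᵥ ((1 / 2 : ℝ) • (a + b)) ≤ 1 / 2 * (a ⬝ᵥ a + b ⬝ᵥ b) := by
  simp only [dotProduct, Fin.sum_univ_two, Pi.smul_apply, Pi.add_apply, smul_eq_mul]
  nlinarith [sq_nonneg (a 0 - b 0), sq_nonneg (a 1 - b 1)]

/-- Young's inequality by completing the square. Nothing of b survives on the right, so jumps
disappear from all later estimates. -/
theorem two_mul_dotProduct_sub_le (a b : Fin 2 → ℝ) {β : ℝ} (hβ : 0 < β) :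
    2 * (a ⬝ᵥ b) - β * (b ⬝ᵥ b) ≤ 1 / β * (a ⬝ᵥ a) := by
  simp only [dotProduct, Fin.sum_univ_two]
  rw [← sub_nonneg]
  have : 1 / β * (a 0 * a 0 + a 1 * a 1) - (2 * (a 0 * b 0 + a 1 * b 1)
      - β * (b 0 * b 0 + b 1 * b 1)) = 1 / β * ((a 0 - β * b 0) ^ 2 + (a 1 - β * b 1) ^ 2) := by
    field_simp; ring
  rw [this]; positivity

/-! ### Line integrals over sides and the trace inequality for the energy density -/

namespace TriMesh

variable {M : TriMesh}

theorem continuous_sidePt (K : Fin M.card) (i : Fin 3) : Continuous (M.sidePt K i) := by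
  unfold sidePt; fun_prop

theorem normal_sq (K : Fin M.card) (i : Fin 3) : M.normal K i 0 ^ 2 + M.normal K i 1 ^ 2 = 1 := by
  have h := sideLen_pos K i
  have h2 : M.sideLen K i ^ 2 = ((M.sideEnd K i).1 - (M.sideStart K i).1) ^ 2
    + ((M.sideEnd K i).2 - (M.sideStart K i).2) ^ 2 := Real.sq_sqrt (by positivity)
  simp only [normal, Matrix.cons_val_zero, Matrix.cons_val_one, Matrix.cons_val_fin_one, div_pow,
    neg_sq, ← add_div]
  rw [div_eq_one_iff_eq (by positivity), h2]
  ring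

theorem sideIntegral_mono (K : Fin M.card) (i : Fin 3) {f g : ℝ → ℝ} (hf : Continuous f)
    (hg : Continuous g) (h : ∀ s, f s ≤ g s) : M.sideIntegral K i f ≤ M.sideIntegral K i g :=
  mul_le_mul_of_nonneg_left (intervalIntegral.integral_mono_on zero_le_one
    (hf.intervalIntegrable _ _) (hg.intervalIntegrable _ _) fun s _ => h s) (sideLen_nonneg K i)

theorem sideIntegral_add (K : Fin M.card) (i : Fin 3) {f g : ℝ → ℝ} (hf : Continuous f)
    (hg : Continuous g) :
    M.sideIntegral K i (fun s => f s + g s) = M.sideIntegral K i f + M.sideIntegral K i g := by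
  simp only [sideIntegral]
  rw [intervalIntegral.integral_add (hf.intervalIntegrable _ _) (hg.intervalIntegrable _ _),
    mul_add]

theorem sideIntegral_const_mul (K : Fin M.card) (i : Fin 3) (c : ℝ) (f : ℝ → ℝ) :
    M.sideIntegral K i (fun s => c * f s) = c * M.sideIntegral K i f := by
  simp only [sideIntegral, intervalIntegral.integral_const_mul]
  ring

theorem sideIntegral_nonneg (K : Fin M.card) (i : Fin 3) {f : ℝ → ℝ} (hf : ∀ s, 0 ≤ f s) :
    0 ≤ M.sideIntegral K i f :=
  mul_nonneg (sideLen_nonneg K i) (intervalIntegral.integral_nonneg zero_le_one fun s _ => hf s)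

/-- The two parametrizations of an interior edge give the same line integrals. -/
theorem sideIntegral_interiorEdge {e : (Fin M.card × Fin 3) × (Fin M.card × Fin 3)}
    (he : e ∈ M.interiorEdges) (f : ℝ × ℝ → ℝ) :
    M.sideIntegral e.1.1 e.1.2 (fun s => f (M.sidePt e.1.1 e.1.2 s))
      = M.sideIntegral e.2.1 e.2.2 (fun s => f (M.sidePt e.2.1 e.2.2 s)) := by
  obtain ⟨-, h1, h2⟩ := mem_interiorEdges.1 he
  have hl : M.sideLen e.1.1 e.1.2 = M.sideLen e.2.1 e.2.2 := by
    simp only [sideLen, h1, h2]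
    congr 1; ring
  have hp (s : ℝ) : M.sidePt e.1.1 e.1.2 s = M.sidePt e.2.1 e.2.2 (1 - s) := by
    simp only [sidePt, h1, h2]
    module
  simp only [sideIntegral, hl, hp]
  rw [intervalIntegral.integral_comp_sub_left (fun s => f (M.sidePt e.2.1 e.2.2 s)) 1]
  simp

theorem integrableOn_tri (K : Fin M.card) {f : ℝ × ℝ → ℝ} (hf : Continuous f) :
    MeasureTheory.IntegrableOn f (M.tri K) :=
  hf.continuousOn.integrableOn_compact (isCompact_tri K)

/-- The density is a positive combination of squares of functions that are polynomial along lines,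
so the scalar trace inequality applies to each square. -/
theorem sideIntegral_energyDensity_le {c : ℝ} (hc : 0 < c)
    (hc' : ∀ g : Polynomial ℝ, g.natDegree ≤ q →
      g.eval 1 ^ 2 ≤ c * ∫ t in (0 : ℝ)..1, g.eval t ^ 2 * t)
    {κ : ℝ} (hκ : 0 ≤ κ) (hM : M.ShapeRegular κ) {mu la : ℝ} (hmu : 0 < mu) (hla : 0 < la)
    (w : Fin 2 → Mono q → ℝ) (K : Fin M.card) (i : Fin 3) :
    M.hmin * M.sideIntegral K i (fun s => energyDensity mu la w (M.sidePt K i s))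
      ≤ c * κ * ∫ p in M.tri K, energyDensity mu la w p := by
  have hp := continuous_sidePt K i
  have t0 := sideIntegral_sq_le hc hc' hκ hM (linePoly_strain w 0 0) K i
  have t1 := sideIntegral_sq_le hc hc' hκ hM (linePoly_strain w 0 1) K i
  have t2 := sideIntegral_sq_le hc hc' hκ hM (linePoly_strain w 1 1) K i
  have t3 := sideIntegral_sq_le hc hc' hκ hM (linePoly_divergence w) K i
  have h0 := (linePoly_strain w 0 0).cont
  have h1 := (linePoly_strain w 0 1).cont
  have h2 := (linePoly_strain w 1 1).cont
  have h3 := (linePoly_divergence w).cont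
  simp only [energyDensity_eq]
  rw [MeasureTheory.integral_add (integrableOn_tri K (by fun_prop))
      (integrableOn_tri K (by fun_prop)),
    MeasureTheory.integral_add (integrableOn_tri K (by fun_prop))
      (integrableOn_tri K (by fun_prop)),
    MeasureTheory.integral_add (integrableOn_tri K (by fun_prop))
      (integrableOn_tri K (by fun_prop)),
    sideIntegral_add, sideIntegral_add, sideIntegral_add]
  · simp only [sideIntegral_const_mul, MeasureTheory.integral_const_mul]
    have := mul_le_mul_of_nonneg_left t0 (by positivity : 0 ≤ 2 * mu)
    have := mul_le_mul_of_nonneg_left t1 (by positivity : 0 ≤ 4 * mu)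
    have := mul_le_mul_of_nonneg_left t2 (by positivity : 0 ≤ 2 * mu)
    have := mul_le_mul_of_nonneg_left t3 hla.le
    linarith
  all_goals fun_prop

end TriMesh

/-! ### Nonnegativity of the discontinuous Galerkin energy `U1` -/

namespace CoupledScheme

variable {S : CoupledScheme q}

theorem continuous_tractionOn (v : DGSpace S.mesh q) (K : Fin S.mesh.card) (n : Fin 2 → ℝ) :
    Continuous (S.tractionOn v K n) := by
  refine continuous_pi fun c => ?_
  have h0 := (linePoly_stress S.muv S.lav (v K) c 0).cont
  have h1 := (linePoly_stress S.muv S.lav (v K) c 1).cont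
  simp only [tractionOn, Matrix.mulVec, dotProduct, Fin.sum_univ_two]
  fun_prop

theorem continuous_avgTraction (v : DGSpace S.mesh q)
    (e : (Fin S.mesh.card × Fin 3) × (Fin S.mesh.card × Fin 3)) :
    Continuous (S.avgTraction v e) := by
  have h1 := continuous_tractionOn v e.1.1 (S.mesh.normal e.1.1 e.1.2)
  have h2 := continuous_tractionOn v e.2.1 (S.mesh.normal e.1.1 e.1.2)
  have hp := TriMesh.continuous_sidePt e.1.1 e.1.2
  unfold avgTraction
  fun_prop

theorem continuous_jump (v : DGSpace S.mesh q)
    (e : (Fin S.mesh.card × Fin 3) × (Fin S.mesh.card × Fin 3)) :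
    Continuous (S.jump v e) := by
  refine continuous_pi fun c => ?_
  have h1 := (linePoly_polyVal (v e.1.1 c)).cont
  have h2 := (linePoly_polyVal (v e.2.1 c)).cont
  have hp := TriMesh.continuous_sidePt e.1.1 e.1.2
  unfold jump
  fun_prop

theorem innerStrain_add_innerDiv (v : DGSpace S.mesh q) :
    2 * S.muv * S.innerStrain v v + S.lav * S.innerDiv v v
      = ∑ K, ∫ p in S.mesh.tri K, energyDensity S.muv S.lav (v K) p := by
  simp only [innerStrain, innerDiv, Finset.mul_sum]
  rw [← Finset.sum_add_distrib]
  refine Finset.sum_congr rfl fun K _ => ?_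
  have h (i j : Fin 2) := (linePoly_strain (v K) i j).cont
  have h3 := (linePoly_divergence (v K)).cont
  rw [← MeasureTheory.integral_const_mul, ← MeasureTheory.integral_const_mul,
    ← MeasureTheory.integral_add]
  · rfl
  · exact TriMesh.integrableOn_tri K (by unfold contract; fun_prop)
  · exact TriMesh.integrableOn_tri K (by fun_prop)

/-- Energy density integrated over a side. -/
def sideEnergy (v : DGSpace S.mesh q) (e : Fin S.mesh.card × Fin 3) : ℝ :=
  S.mesh.sideIntegral e.1 e.2 fun s => energyDensity S.muv S.lav (v e.1) (S.mesh.sidePt e.1 e.2 s)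

theorem sideEnergy_nonneg (hmu : 0 < S.muv) (hla : 0 < S.lav) (v : DGSpace S.mesh q)
    (e : Fin S.mesh.card × Fin 3) : 0 ≤ sideEnergy v e :=
  TriMesh.sideIntegral_nonneg _ _ fun _ => energyDensity_nonneg hmu hla _ _

/-- Young's inequality with the penalty weight as β removes the jump, whatever its scaling
`jumpScale`. The squared average traction is at most χ₁ times the sum of the two densities, which
gives the factor h_v/α_I ≤ 4C h_v per edge. A side may occur as first or as second side of an edge,
whence 8C. -/
theorem interiorFlux_le (hmu : 0 < S.muv) (hla : 0 < S.lav) {C : ℝ} (hC : 0 < C)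
    (hα : 1 / (4 * C) ≤ S.alphaI) (hh : 0 < S.hv) (v : DGSpace S.mesh q) :
    S.interiorFlux v v ≤ 8 * C * S.hv * ∑ K, ∑ i, sideEnergy v (K, i) := by
  have hχ : 0 < 2 * S.muv + S.lav := by positivity
  have hα0 : 0 < S.alphaI := lt_of_lt_of_le (by positivity) hα
  have hα' : 1 / S.alphaI ≤ 4 * C := by
    rw [div_le_iff₀ hα0]
    rw [div_le_iff₀ (by positivity)] at hα
    linarith
  have key : S.interiorFlux v v
      ≤ ∑ e ∈ S.mesh.interiorEdges, 4 * C * S.hv * (sideEnergy v e.1 + sideEnergy v e.2) := by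
    refine Finset.sum_le_sum fun e he => ?_
    have hp := TriMesh.continuous_sidePt (M := S.mesh) e.1.1 e.1.2
    have hW1 := continuous_energyDensity S.muv S.lav (v e.1.1)
    have hW2 := continuous_energyDensity S.muv S.lav (v e.2.1)
    have ha := continuous_avgTraction v e
    have hj := continuous_jump v e
    -- The energy of the neighbour is moved to the parametrization from K⁺, in which the flux is
    -- written.
    rw [sideEnergy, sideEnergy, ← TriMesh.sideIntegral_interiorEdge he
      (energyDensity S.muv S.lav (v e.2.1)), ← TriMesh.sideIntegral_add _ _ (by fun_prop)
      (by fun_prop), ← TriMesh.sideIntegral_const_mul]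
    refine TriMesh.sideIntegral_mono _ _ ?_ (by fun_prop) fun s => ?_
    · simp only [dotProduct, Fin.sum_univ_two]
      fun_prop
    set p := S.mesh.sidePt e.1.1 e.1.2 s
    set n := S.mesh.normal e.1.1 e.1.2
    have hn : n 0 ^ 2 + n 1 ^ 2 = 1 := TriMesh.normal_sq _ _
    have h1 := two_mul_dotProduct_sub_le (S.avgTraction v e s) (S.jump v e s)
      (β := S.alphaI / S.hv * (2 * S.muv + S.lav)) (by positivity)
    have h2 := dotProduct_half_smul_add_le (S.tractionOn v e.1.1 n p) (S.tractionOn v e.2.1 n p)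
    have h3 : S.tractionOn v e.1.1 n p ⬝ᵥ S.tractionOn v e.1.1 n p ≤ _ :=
      traction_sq_le hmu hla (v e.1.1) p hn
    have h4 : S.tractionOn v e.2.1 n p ⬝ᵥ S.tractionOn v e.2.1 n p ≤ _ :=
      traction_sq_le hmu hla (v e.2.1) p hn
    change S.avgTraction v e s ⬝ᵥ S.avgTraction v e s ≤ _ at h2
    have hWW := add_nonneg (energyDensity_nonneg hmu hla (v e.1.1) p)
      (energyDensity_nonneg hmu hla (v e.2.1) p)
    calc _ = 2 * (S.avgTraction v e s ⬝ᵥ S.jump v e s)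
          - S.alphaI / S.hv * (2 * S.muv + S.lav) * (S.jump v e s ⬝ᵥ S.jump v e s) := by ring
      _ ≤ _ := h1
      _ ≤ 1 / (S.alphaI / S.hv * (2 * S.muv + S.lav)) * ((2 * S.muv + S.lav)
          * (energyDensity S.muv S.lav (v e.1.1) p + energyDensity S.muv S.lav (v e.2.1) p)) := by
        gcongr
        linarith
      _ = 1 / S.alphaI * S.hv
          * (energyDensity S.muv S.lav (v e.1.1) p + energyDensity S.muv S.lav (v e.2.1) p) := by
        field_simp
      _ ≤ _ := by gcongr
  rw [← Finset.mul_sum, Finset.sum_add_distrib] at key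
  have s1 := TriMesh.sum_interiorEdges_fst_le (sideEnergy_nonneg hmu hla v)
  have s2 := TriMesh.sum_interiorEdges_snd_le (sideEnergy_nonneg hmu hla v)
  calc _ ≤ _ := key
    _ ≤ 4 * C * S.hv * (∑ K, ∑ i, sideEnergy v (K, i) + ∑ K, ∑ i, sideEnergy v (K, i)) := by
      gcongr
    _ = _ := by ring

/-- The same absorption on Γ, for an arbitrary nodal vector z in place of the displacement jump.
Each interface edge costs 2C h_v times the energy of its one adjacent side. -/
theorem interface_ge (hn : Function.Injective S.nodes) (hmu : 0 < S.muv) (hla : 0 < S.lav)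
    {C : ℝ} (hC : 0 < C) (hα : 1 / (4 * C) ≤ S.alphav) (hh : 0 < S.hv) (v : DGSpace S.mesh q)
    (z : S.GVec) :
    -(2 * C * S.hv * ∑ K, ∑ i, sideEnergy v (K, i))
      ≤ S.chi1 * S.alphav / S.hv * (z ⬝ᵥ S.MG *ᵥ z) - z ⬝ᵥ S.MG *ᵥ S.Tv v := by
  have hχ : 0 < 2 * S.muv + S.lav := by positivity
  have hα0 : 0 < S.alphav := lt_of_lt_of_le (by positivity) hα
  have hα' : 1 / (4 * S.alphav) ≤ C := by
    rw [div_le_iff₀ (by positivity)]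
    rw [div_le_iff₀ (by positivity)] at hα
    linarith
  have key : z ⬝ᵥ S.MG *ᵥ S.Tv v ≤ S.chi1 * S.alphav / S.hv * (z ⬝ᵥ S.MG *ᵥ z)
      + ∑ e : S.GEdge, 2 * C * S.hv * sideEnergy v e.1 := by
    rw [dotProduct_MG_mulVec, dotProduct_MG_mulVec, innerEdges, innerEdges, Finset.mul_sum,
      ← Finset.sum_add_distrib]
    refine Finset.sum_le_sum fun e _ => ?_
    have hp := TriMesh.continuous_sidePt (M := S.mesh) e.1.1 e.1.2
    have hW := continuous_energyDensity S.muv S.lav (v e.1.1)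
    have hz := continuous_edgeFun z e
    have hT := continuous_edgeFun (S.Tv v) e
    rw [sideEnergy, ← TriMesh.sideIntegral_const_mul, ← TriMesh.sideIntegral_const_mul,
      ← TriMesh.sideIntegral_add _ _
        (by simp only [dotProduct, Fin.sum_univ_two]; fun_prop) (by fun_prop)]
    refine TriMesh.sideIntegral_mono _ _ (by simp only [dotProduct, Fin.sum_univ_two]; fun_prop)
      (by simp only [dotProduct, Fin.sum_univ_two]; fun_prop) fun s => ?_
    rw [edgeFun_Tv hn]
    set p := S.mesh.sidePt e.1.1 e.1.2 s
    set a := S.edgeFun z e s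
    set t := S.edgeTraction v e s
    -- The product occurs only once here, so the inequality is taken with twice the penalty weight
    -- and then halved.
    have h1 := two_mul_dotProduct_sub_le t a (β := 2 * (S.chi1 * S.alphav / S.hv))
      (by unfold chi1; positivity)
    have h3 : t ⬝ᵥ t ≤ _ := traction_sq_le hmu hla (v e.1.1) p (n := ![0, 1]) (by simp)
    have hW0 := energyDensity_nonneg hmu hla (v e.1.1) p
    have h4 : 1 / (2 * (S.chi1 * S.alphav / S.hv)) * (t ⬝ᵥ t)
        ≤ 2 * (2 * C * S.hv * energyDensity S.muv S.lav (v e.1.1) p) := by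
      calc _ ≤ 1 / (2 * (S.chi1 * S.alphav / S.hv))
            * (2 * (2 * S.muv + S.lav) * energyDensity S.muv S.lav (v e.1.1) p) := by
            have : 0 < S.chi1 := hχ
            gcongr
        _ = 4 * (1 / (4 * S.alphav) * S.hv * energyDensity S.muv S.lav (v e.1.1) p) := by
            unfold chi1; field_simp
        _ ≤ 4 * (C * S.hv * energyDensity S.muv S.lav (v e.1.1) p) := by gcongr
        _ = _ := by ring
    rw [dotProduct_comm t a] at h1
    linarith
  rw [← Finset.mul_sum] at key
  have s1 := TriMesh.sum_ifaceSide_le (a := S.a) (b := S.b) (y₀ := S.y₀)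
    (sideEnergy_nonneg hmu hla v)
  have := mul_le_mul_of_nonneg_left s1 (by positivity : 0 ≤ 2 * C * S.hv)
  linarith

theorem U1_nonneg {c κ : ℝ} (hc : 0 < c) (hc' : ∀ g : Polynomial ℝ, g.natDegree ≤ q →
      g.eval 1 ^ 2 ≤ c * ∫ t in (0 : ℝ)..1, g.eval t ^ 2 * t)
    (hκ : 0 < κ) (hM : S.mesh.ShapeRegular κ) (hh : 0 < S.hv)
    (hn : Function.Injective S.nodes) (hmu : 0 < S.muv) (hla : 0 < S.lav)
    (hα : 1 / (4 * (1 / (30 * c * κ))) ≤ S.alphav)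
    (hαI : 1 / (4 * (1 / (30 * c * κ))) ≤ S.alphaI) (u : S.Grid) (v : DGSpace S.mesh q) :
    0 ≤ S.U1 u v := by
  -- The 30 is (8 + 2)·3: 8C from interior edges, 2C from the interface, and three sides per
  -- triangle in the trace inequality. With it the bounded terms consume exactly the volume energy.
  set C := 1 / (30 * c * κ) with hCdef
  have hC : 0 < C := by positivity
  set g := S.projUV S.Pguv *ᵥ (S.BG *ᵥ u) with hg
  have e1 : S.U1 u v = (2 * S.muv * S.innerStrain v v + S.lav * S.innerDiv v v)
      - S.interiorFlux v v + (S.chi1 * S.alphav / S.hv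
        * ((S.traceG v - g) ⬝ᵥ S.MG *ᵥ (S.traceG v - g)) - (S.traceG v - g) ⬝ᵥ S.MG *ᵥ S.Tv v) := by
    have := dotProduct_mulVec_comm_of_transpose_eq (MG_transpose (S := S)) g (S.traceG v)
    rw [U1, ← hg]
    simp only [Matrix.mulVec_sub, dotProduct_sub, sub_dotProduct, this]
    ring
  have h1 := interiorFlux_le hmu hla hC hαI hh v
  have h2 := interface_ge hn hmu hla hC hα hh v (S.traceG v - g)
  have h3 : S.hv * ∑ K, ∑ i, sideEnergy v (K, i)
      ≤ 3 * (c * κ * ∑ K, ∫ p in S.mesh.tri K, energyDensity S.muv S.lav (v K) p) := by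
    simp only [Finset.mul_sum]
    refine Finset.sum_le_sum fun K _ => ?_
    have := Finset.sum_le_sum fun i (_ : i ∈ (Finset.univ : Finset (Fin 3))) =>
      TriMesh.sideIntegral_energyDensity_le hc hc' hκ.le hM hmu hla (v K) K i
    exact this.trans_eq (by simp)
  rw [e1, innerStrain_add_innerDiv]
  have h4 := mul_le_mul_of_nonneg_left h3 (by positivity : 0 ≤ 10 * C)
  have h5 : 10 * C * (3 * (c * κ * ∑ K, ∫ p in S.mesh.tri K,
      energyDensity S.muv S.lav (v K) p))
      = ∑ K, ∫ p in S.mesh.tri K, energyDensity S.muv S.lav (v K) p := by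
    rw [hCdef]; field_simp; ring
  linarith

end CoupledScheme

/-! ### Bilinear maps -/

theorem isBilinearMap_of_symm {E : Type*} [AddCommGroup E] [Module ℝ E] {f : E → E → ℝ}
    (hs : ∀ x y, f x y = f y x) (ha : ∀ x x' y, f (x + x') y = f x y + f x' y)
    (hm : ∀ (c : ℝ) x y, f (c • x) y = c • f x y) : IsBilinearMap ℝ f where
  add_left := ha
  smul_left := hm
  add_right x y y' := by rw [hs, ha, hs y, hs y']
  smul_right c x y := by rw [hs, hm, hs]

/-- Bilinear maps on finite-dimensional spaces are continuous, so the energies can be differentiated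
by the product rule without differentiating under an integral. -/
theorem _root_.IsBilinearMap.hasDerivWithinAt {E F : Type*} [NormedAddCommGroup E]
    [NormedSpace ℝ E] [FiniteDimensional ℝ E] [NormedAddCommGroup F] [NormedSpace ℝ F]
    [FiniteDimensional ℝ F] {f : E → F → ℝ} (hf : IsBilinearMap ℝ f) {x : ℝ → E} {y : ℝ → F}
    {x' : E} {y' : F} {s : Set ℝ} {t : ℝ} (hx : HasDerivWithinAt x x' s t)
    (hy : HasDerivWithinAt y y' s t) :
    HasDerivWithinAt (fun r => f (x r) (y r)) (f (x t) y' + f x' (y t)) s t :=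
  hf.toContinuousBilinearMap.hasDerivWithinAt_of_bilinear hx hy

theorem _root_.IsBilinearMap.continuous_diag {E : Type*} [NormedAddCommGroup E]
    [NormedSpace ℝ E] [FiniteDimensional ℝ E] {f : E → E → ℝ} (hf : IsBilinearMap ℝ f) :
    Continuous fun x : E => f x x :=
  hf.toContinuousBilinearMap.isBoundedBilinearMap.continuous.comp
    (continuous_id.prodMk continuous_id)

theorem _root_.IsLinearMap.hasDerivWithinAt {E F : Type*} [NormedAddCommGroup E]
    [NormedSpace ℝ E] [FiniteDimensional ℝ E] [NormedAddCommGroup F] [NormedSpace ℝ F]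
    {f : E → F} (hf : IsLinearMap ℝ f) {x : ℝ → E} {x' : E} {s : Set ℝ} {t : ℝ}
    (hx : HasDerivWithinAt x x' s t) : HasDerivWithinAt (fun r => f (x r)) (f x') s t :=
  (LinearMap.toContinuousLinearMap (hf.mk' f)).hasFDerivAt.comp_hasDerivWithinAt t hx

theorem _root_.IsLinearMap.continuous {E F : Type*} [NormedAddCommGroup E]
    [NormedSpace ℝ E] [FiniteDimensional ℝ E] [NormedAddCommGroup F] [NormedSpace ℝ F]
    {f : E → F} (hf : IsLinearMap ℝ f) : Continuous f :=
  (LinearMap.toContinuousLinearMap (hf.mk' f)).continuous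

theorem isLinearMap_mulVec {m n : Type*} [Fintype n] (A : Matrix m n ℝ) :
    IsLinearMap ℝ fun x : n → ℝ => A *ᵥ x :=
  ⟨fun x y => Matrix.mulVec_add A x y, fun c x => Matrix.mulVec_smul A c x⟩

theorem isBilinearMap_dotProduct_mulVec {m n : Type*} [Fintype m] [Fintype n]
    (A : Matrix m n ℝ) : IsBilinearMap ℝ fun (x : m → ℝ) (y : n → ℝ) => x ⬝ᵥ A *ᵥ y where
  add_left x x' y := add_dotProduct _ _ _
  smul_left c x y := smul_dotProduct _ _ _
  add_right x y y' := by rw [Matrix.mulVec_add, dotProduct_add]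
  smul_right c x y := by rw [Matrix.mulVec_smul, dotProduct_smul]

/-! ### Linear dependence on the coefficients -/

theorem polyVal_add (c d : Mono q → ℝ) (p : ℝ × ℝ) :
    polyVal (c + d) p = polyVal c p + polyVal d p := by
  simp [polyVal, add_mul, Finset.sum_add_distrib]

theorem polyVal_smul (r : ℝ) (c : Mono q → ℝ) (p : ℝ × ℝ) :
    polyVal (r • c) p = r * polyVal c p := by
  simp [polyVal, mul_assoc, Finset.mul_sum]

theorem polyDx_add (c d : Mono q → ℝ) (p : ℝ × ℝ) :
    polyDx (c + d) p = polyDx c p + polyDx d p := by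
  simp [polyDx, add_mul, Finset.sum_add_distrib]

theorem polyDx_smul (r : ℝ) (c : Mono q → ℝ) (p : ℝ × ℝ) :
    polyDx (r • c) p = r * polyDx c p := by
  simp [polyDx, mul_assoc, Finset.mul_sum]

theorem polyDy_add (c d : Mono q → ℝ) (p : ℝ × ℝ) :
    polyDy (c + d) p = polyDy c p + polyDy d p := by
  simp [polyDy, add_mul, Finset.sum_add_distrib]

theorem polyDy_smul (r : ℝ) (c : Mono q → ℝ) (p : ℝ × ℝ) :
    polyDy (r • c) p = r * polyDy c p := by
  simp [polyDy, mul_assoc, Finset.mul_sum]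

theorem jac_add (v w : Fin 2 → Mono q → ℝ) (p : ℝ × ℝ) : jac (v + w) p = jac v p + jac w p := by
  ext i j
  fin_cases i <;> fin_cases j <;> simp [jac, polyDx_add, polyDy_add]

theorem jac_smul (r : ℝ) (v : Fin 2 → Mono q → ℝ) (p : ℝ × ℝ) : jac (r • v) p = r • jac v p := by
  ext i j
  fin_cases i <;> fin_cases j <;> simp [jac, polyDx_smul, polyDy_smul]

theorem divergence_add (v w : Fin 2 → Mono q → ℝ) (p : ℝ × ℝ) :
    divergence (v + w) p = divergence v p + divergence w p := by
  simp [divergence, jac_add]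

theorem divergence_smul (r : ℝ) (v : Fin 2 → Mono q → ℝ) (p : ℝ × ℝ) :
    divergence (r • v) p = r * divergence v p := by
  simp [divergence, jac_smul]

theorem strain_add (v w : Fin 2 → Mono q → ℝ) (p : ℝ × ℝ) :
    strain (v + w) p = strain v p + strain w p := by
  simp only [strain, jac_add, Matrix.transpose_add]
  module

theorem strain_smul (r : ℝ) (v : Fin 2 → Mono q → ℝ) (p : ℝ × ℝ) :
    strain (r • v) p = r • strain v p := by
  simp only [strain, jac_smul, Matrix.transpose_smul]
  module

theorem stress_add (mu la : ℝ) (v w : Fin 2 → Mono q → ℝ) (p : ℝ × ℝ) :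
    stress mu la (v + w) p = stress mu la v p + stress mu la w p := by
  ext i j
  fin_cases i <;> fin_cases j <;> simp [stress, polyDx_add, polyDy_add] <;> ring

theorem stress_smul (mu la r : ℝ) (v : Fin 2 → Mono q → ℝ) (p : ℝ × ℝ) :
    stress mu la (r • v) p = r • stress mu la v p := by
  ext i j
  fin_cases i <;> fin_cases j <;> simp [stress, polyDx_smul, polyDy_smul] <;> ring

theorem contract_comm (A B : Matrix (Fin 2) (Fin 2) ℝ) : contract A B = contract B A := by
  simp only [contract, mul_comm]

theorem contract_add (A A' B : Matrix (Fin 2) (Fin 2) ℝ) :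
    contract (A + A') B = contract A B + contract A' B := by
  simp [contract, add_mul, Finset.sum_add_distrib]

theorem contract_smul (r : ℝ) (A B : Matrix (Fin 2) (Fin 2) ℝ) :
    contract (r • A) B = r * contract A B := by
  simp only [contract, Matrix.smul_apply, smul_eq_mul, mul_assoc, Finset.mul_sum]

theorem continuous_contract_strain (v w : Fin 2 → Mono q → ℝ) :
    Continuous fun p => contract (strain v p) (strain w p) := by
  have h (i j : Fin 2) := (linePoly_strain v i j).cont
  have h' (i j : Fin 2) := (linePoly_strain w i j).cont
  unfold contract
  fun_prop

namespace CoupledScheme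

variable {S : CoupledScheme q}

theorem isLinearMap_traceG : IsLinearMap ℝ S.traceG where
  map_add v w := by funext d; simp [traceG, polyVal_add]
  map_smul r v := by funext d; simp [traceG, polyVal_smul]

theorem tractionOn_add (v w : DGSpace S.mesh q) (K : Fin S.mesh.card) (n : Fin 2 → ℝ)
    (p : ℝ × ℝ) : S.tractionOn (v + w) K n p = S.tractionOn v K n p + S.tractionOn w K n p := by
  simp [tractionOn, stress_add, Matrix.add_mulVec]

theorem tractionOn_smul (r : ℝ) (v : DGSpace S.mesh q) (K : Fin S.mesh.card) (n : Fin 2 → ℝ)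
    (p : ℝ × ℝ) : S.tractionOn (r • v) K n p = r • S.tractionOn v K n p := by
  simp [tractionOn, stress_smul, Matrix.smul_mulVec]

theorem isLinearMap_Tv : IsLinearMap ℝ S.Tv where
  map_add v w := by
    funext d
    exact congrFun (tractionOn_add v w _ _ _) _
  map_smul r v := by
    funext d
    exact congrFun (tractionOn_smul r v _ _ _) _

theorem isBilinearMap_innerV : IsBilinearMap ℝ S.innerV := by
  have hc (v w : DGSpace S.mesh q) (K : Fin S.mesh.card) :
      Continuous fun p => ∑ c, polyVal (v K c) p * polyVal (w K c) p :=
    continuous_finsetSum _ fun c _ =>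
      (linePoly_polyVal (v K c)).cont.mul (linePoly_polyVal (w K c)).cont
  refine isBilinearMap_of_symm (fun v w => ?_) (fun v v' w => ?_) fun r v w => ?_
  · simp only [innerV, mul_comm]
  · simp only [innerV]
    rw [← Finset.sum_add_distrib]
    refine Finset.sum_congr rfl fun K _ => ?_
    rw [← MeasureTheory.integral_add (TriMesh.integrableOn_tri K (hc v w K))
      (TriMesh.integrableOn_tri K (hc v' w K))]
    simp only [Pi.add_apply, polyVal_add, add_mul, Finset.sum_add_distrib]
  · simp only [innerV, Pi.smul_apply, polyVal_smul, mul_assoc, ← Finset.mul_sum,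
      MeasureTheory.integral_const_mul, smul_eq_mul]

theorem isBilinearMap_innerStrain : IsBilinearMap ℝ S.innerStrain := by
  refine isBilinearMap_of_symm (fun v w => ?_) (fun v v' w => ?_) fun r v w => ?_
  · simp only [innerStrain, contract_comm]
  · simp only [innerStrain]
    rw [← Finset.sum_add_distrib]
    refine Finset.sum_congr rfl fun K _ => ?_
    rw [← MeasureTheory.integral_add
      (TriMesh.integrableOn_tri K (continuous_contract_strain (v K) (w K)))
      (TriMesh.integrableOn_tri K (continuous_contract_strain (v' K) (w K)))]
    simp only [Pi.add_apply, strain_add, contract_add]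
  · simp only [innerStrain, Pi.smul_apply, strain_smul, contract_smul, ← Finset.mul_sum,
      MeasureTheory.integral_const_mul, smul_eq_mul]

theorem isBilinearMap_innerDiv : IsBilinearMap ℝ S.innerDiv := by
  have hc (v w : DGSpace S.mesh q) (K : Fin S.mesh.card) :
      Continuous fun p => divergence (v K) p * divergence (w K) p :=
    (linePoly_divergence (v K)).cont.mul (linePoly_divergence (w K)).cont
  refine isBilinearMap_of_symm (fun v w => ?_) (fun v v' w => ?_) fun r v w => ?_
  · simp only [innerDiv, mul_comm]
  · simp only [innerDiv]
    rw [← Finset.sum_add_distrib]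
    refine Finset.sum_congr rfl fun K _ => ?_
    rw [← MeasureTheory.integral_add (TriMesh.integrableOn_tri K (hc v w K))
      (TriMesh.integrableOn_tri K (hc v' w K))]
    simp only [Pi.add_apply, divergence_add, add_mul]
  · simp only [innerDiv, Pi.smul_apply, divergence_smul, mul_assoc, ← Finset.mul_sum,
      MeasureTheory.integral_const_mul, smul_eq_mul]

theorem avgTraction_add (v w : DGSpace S.mesh q)
    (e : (Fin S.mesh.card × Fin 3) × (Fin S.mesh.card × Fin 3)) (s : ℝ) :
    S.avgTraction (v + w) e s = S.avgTraction v e s + S.avgTraction w e s := by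
  simp only [avgTraction, tractionOn_add]
  module

theorem avgTraction_smul (r : ℝ) (v : DGSpace S.mesh q)
    (e : (Fin S.mesh.card × Fin 3) × (Fin S.mesh.card × Fin 3)) (s : ℝ) :
    S.avgTraction (r • v) e s = r • S.avgTraction v e s := by
  simp only [avgTraction, tractionOn_smul]
  module

theorem jump_add (v w : DGSpace S.mesh q)
    (e : (Fin S.mesh.card × Fin 3) × (Fin S.mesh.card × Fin 3)) (s : ℝ) :
    S.jump (v + w) e s = S.jump v e s + S.jump w e s := by
  funext c
  simp only [jump, Pi.add_apply, polyVal_add]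
  ring

theorem jump_smul (r : ℝ) (v : DGSpace S.mesh q)
    (e : (Fin S.mesh.card × Fin 3) × (Fin S.mesh.card × Fin 3)) (s : ℝ) :
    S.jump (r • v) e s = r • S.jump v e s := by
  funext c
  simp only [jump, Pi.smul_apply, polyVal_smul, smul_eq_mul]
  ring

theorem interiorFlux_comm (v w : DGSpace S.mesh q) : S.interiorFlux v w = S.interiorFlux w v := by
  simp only [interiorFlux, add_comm (S.avgTraction v _ _ ⬝ᵥ _),
    dotProduct_comm (S.jump v _ _) (S.jump w _ _)]

theorem isBilinearMap_interiorFlux : IsBilinearMap ℝ S.interiorFlux := by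
  have hc (v w : DGSpace S.mesh q) (e) : Continuous fun s =>
      S.avgTraction v e s ⬝ᵥ S.jump w e s + S.avgTraction w e s ⬝ᵥ S.jump v e s
      - S.alphaI / S.hv * (2 * S.muv + S.lav) * (S.jump v e s ⬝ᵥ S.jump w e s) := by
    have h1 := continuous_avgTraction v e
    have h2 := continuous_avgTraction w e
    have h3 := continuous_jump v e
    have h4 := continuous_jump w e
    fun_prop
  refine isBilinearMap_of_symm interiorFlux_comm (fun v v' w => ?_) fun r v w => ?_
  · simp only [interiorFlux]
    rw [← Finset.sum_add_distrib]
    refine Finset.sum_congr rfl fun e _ => ?_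
    rw [← TriMesh.sideIntegral_add _ _ (hc v w e) (hc v' w e)]
    congr 1
    funext s
    simp only [avgTraction_add, jump_add, add_dotProduct, dotProduct_add]
    ring
  · simp only [interiorFlux, smul_eq_mul, Finset.mul_sum]
    refine Finset.sum_congr rfl fun e _ => ?_
    rw [← TriMesh.sideIntegral_const_mul]
    congr 1
    funext s
    simp only [avgTraction_smul, jump_smul, smul_dotProduct, dotProduct_smul, smul_eq_mul]
    ring

end CoupledScheme

namespace CoupledScheme

variable {S : CoupledScheme q}

/-! ### Energy balance -/

theorem BG_transpose : S.BGᵀ = S.BG := by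
  simp [BG, alongY_eq, tensor_transpose, B0_transpose]

theorem BG_mul_alongX (F : Matrix (Fin (S.Nx + 1)) (Fin (S.Nx + 1)) ℝ) :
    S.BG * S.alongX F = S.alongX F * S.BG := by
  simp [BG, alongX_eq, alongY_eq, tensor_mul]

theorem BG_mul_Tu : S.BG * S.Tu = S.Tu := by
  rw [Tu, Matrix.mul_neg, ← Matrix.mul_assoc, BG_mul_self]

theorem dotProduct_BG_mulVec (d y : S.Grid) :
    d ⬝ᵥ (S.BG * S.alongX S.Hx) *ᵥ y = (S.BG *ᵥ d) ⬝ᵥ S.alongX S.Hx *ᵥ y := by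
  rw [← Matrix.mulVec_mulVec, Matrix.dotProduct_mulVec, ← Matrix.mulVec_transpose, BG_transpose]

theorem dotProduct_Tu_transpose_mulVec (d y : S.Grid) :
    d ⬝ᵥ (S.Tuᵀ * S.alongX S.Hx) *ᵥ y = (S.Tu *ᵥ d) ⬝ᵥ S.alongX S.Hx *ᵥ y := by
  rw [← Matrix.mulVec_mulVec, Matrix.dotProduct_mulVec, Matrix.vecMul_transpose]

theorem dotProduct_alongX_Tu (d u : S.Grid) :
    d ⬝ᵥ (S.alongX S.Hx * S.Tu) *ᵥ u = (S.BG *ᵥ d) ⬝ᵥ S.alongX S.Hx *ᵥ (S.Tu *ᵥ u) := by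
  rw [← dotProduct_BG_mulVec, Matrix.mulVec_mulVec, BG_mul_alongX, Matrix.mul_assoc, BG_mul_Tu]

/-- Norm compatibility of the full-size projections. -/
theorem NormCompatible.full {Puv : Matrix S.GDof (Fin (S.Nx + 1)) ℝ}
    {Pvu : Matrix (Fin (S.Nx + 1)) S.GDof ℝ} (h : S.NormCompatible Puv Pvu) :
    S.alongX S.Hx * S.projVU Pvu = (S.projUV Puv)ᵀ * S.MG := by
  have hP : (Matrix.of fun d (p : S.GridIdx) => if p.2 = 0 then Puv d p.1 else 0)ᵀ * S.massG
      = (S.Hx ⊗ₖ (1 : Matrix (Fin (S.Ny + 1)) (Fin (S.Ny + 1)) ℝ))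
        * (Matrix.of fun (p : S.GridIdx) d => if p.2 = 0 then Pvu p.1 d else 0) := by
    have hM : S.massGᵀ = S.massG := by
      ext d d'
      have := congrFun (congrFun (MG_transpose (S := S)) (0, d)) (0, d')
      simpa [MG] using this
    have h' : Puvᵀ * S.massG = S.Hx * Pvu := by
      have := congrArg Matrix.transpose h
      rwa [Matrix.transpose_transpose, Matrix.transpose_mul, hM] at this
    ext ⟨i, j⟩ d
    have hij := congrFun (congrFun h' i) d
    simp only [Matrix.mul_apply, Matrix.transpose_apply, Matrix.of_apply, Fintype.sum_prod_type
      (f := fun x : S.GridIdx => _), Matrix.kroneckerMap_apply, Matrix.one_apply] at hij ⊢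
    by_cases hj : j = 0
    · subst hj
      simpa using hij
    · simp [hj]
  rw [projVU, projUV, MG, alongX, ← Matrix.kroneckerMap_transpose, ← Matrix.mul_kronecker_mul,
    ← Matrix.mul_kronecker_mul, hP, Matrix.transpose_one]

/-- Norm compatibility as adjointness: projecting to the grid against H_x equals projecting to the
edges against the mass matrix. This is what lets the coupling terms of the two equations cancel. -/
theorem NormCompatible.dotProduct {Puv : Matrix S.GDof (Fin (S.Nx + 1)) ℝ}
    {Pvu : Matrix (Fin (S.Nx + 1)) S.GDof ℝ} (h : S.NormCompatible Puv Pvu) (d : S.Grid)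
    (y : S.GVec) :
    d ⬝ᵥ S.alongX S.Hx *ᵥ (S.projVU Pvu *ᵥ y) = (S.projUV Puv *ᵥ d) ⬝ᵥ S.MG *ᵥ y := by
  rw [Matrix.mulVec_mulVec, h.full, ← Matrix.mulVec_mulVec, Matrix.dotProduct_mulVec,
    Matrix.vecMul_transpose]

/-- The grid equations tested with a grid function. -/
theorem FDEquation.test (hx : IsCompatible S.Hx S.Dx S.Dxx S.Sx S.Rx)
    (hy : IsFullyCompatible S.Hy S.Dy S.Dyy S.Ry) (hgb : S.NormCompatible S.Pguv S.Pbvu)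
    {u utt : S.Grid} {v : DGSpace S.mesh q} (h : S.FDEquation u utt v) (d : S.Grid) :
    S.rhou * (d ⬝ᵥ S.H *ᵥ utt) = -(d ⬝ᵥ S.Umat *ᵥ u)
      + 1 / 2 * ((S.BG *ᵥ d) ⬝ᵥ S.alongX S.Hx *ᵥ (S.Tu *ᵥ u))
      - 1 / 2 * ((S.projUV S.Pguv *ᵥ (S.BG *ᵥ d)) ⬝ᵥ S.MG *ᵥ S.Tv v)
      + 1 / 2 * ((S.Tu *ᵥ d) ⬝ᵥ S.alongX S.Hx *ᵥ (S.BG *ᵥ u - S.projVU S.Pgvu *ᵥ S.traceG v))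
      - S.chi1 * S.alphau / S.hv * ((S.projUV S.Pguv *ᵥ (S.BG *ᵥ d)) ⬝ᵥ
          S.MG *ᵥ (S.projUV S.Pguv *ᵥ (S.BG *ᵥ u) - S.traceG v))
      - S.chi2 * S.betau / S.hu * ((S.BG *ᵥ d) ⬝ᵥ
          S.alongX S.Hx *ᵥ (S.BG *ᵥ u - S.projVU S.Pgvu *ᵥ S.traceG v)) := by
  have hH : IsUnit S.H.det := by
    have : S.H.PosDef := by
      rw [H_eq]
      exact Matrix.PosDef.one.kronecker (hx.isSBP.posDef.kronecker hy.isSBP.posDef)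
    exact this.det_pos.ne'.isUnit
  have hinv (y : S.Grid) : S.H *ᵥ (S.H⁻¹ *ᵥ y) = y := by
    rw [Matrix.mulVec_mulVec, Matrix.mul_nonsing_inv _ hH, Matrix.one_mulVec]
  have hb : S.H *ᵥ S.fdBulk u = -(S.Umat *ᵥ u) + (S.alongX S.Hx * S.Tu) *ᵥ u := by
    change S.H *ᵥ (S.bulkMat *ᵥ u) = _
    rw [Matrix.mulVec_mulVec, H_mul_bulkMat hx hy, Matrix.add_mulVec, Matrix.neg_mulVec]
  have h1 := congrArg (fun y => d ⬝ᵥ S.H *ᵥ y) h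
  simp only [Matrix.mulVec_smul, dotProduct_smul, smul_eq_mul, Matrix.mulVec_sub,
    Matrix.mulVec_add, hb, fdCoupling, fdPenalty, hinv] at h1
  rw [h1]
  -- `hgb` moves the bad projection onto the test function as the good one, so these terms appear in
  -- the mass-matrix pairings of U₁.
  simp only [dotProduct_sub, dotProduct_add, dotProduct_neg, dotProduct_smul, smul_eq_mul,
    dotProduct_alongX_Tu, dotProduct_BG_mulVec, dotProduct_Tu_transpose_mulVec,
    ← Matrix.mulVec_mulVec (M := S.BG * S.alongX S.Hx) (N := S.projVU S.Pbvu),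
    hgb.dotProduct, Matrix.mulVec_sub]
  ring

/-- The discontinuous Galerkin equations in terms of nodal values. -/
theorem DGEquation.test (hn : Function.Injective S.nodes) (hbg : S.NormCompatible S.Pbuv S.Pgvu)
    {u : S.Grid} {v vtt : DGSpace S.mesh q} (h : S.DGEquation u v vtt) (w : DGSpace S.mesh q) :
    S.rhov * S.innerV vtt w = -(S.lav * S.innerDiv v w) - 2 * S.muv * S.innerStrain v w
      + S.interiorFlux v w
      + 1 / 2 * ((S.traceG v - S.projUV S.Pguv *ᵥ (S.BG *ᵥ u)) ⬝ᵥ S.MG *ᵥ S.Tv w)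
      + 1 / 2 * (S.Tv v ⬝ᵥ S.MG *ᵥ S.traceG w
        - (S.Tu *ᵥ u) ⬝ᵥ S.alongX S.Hx *ᵥ (S.projVU S.Pgvu *ᵥ S.traceG w))
      - S.chi1 * S.alphav / S.hv
        * ((S.traceG v - S.projUV S.Pguv *ᵥ (S.BG *ᵥ u)) ⬝ᵥ S.MG *ᵥ S.traceG w)
      - S.chi2 * S.betav / S.hu * ((S.projVU S.Pgvu *ᵥ S.traceG v - S.BG *ᵥ u) ⬝ᵥ
          S.alongX S.Hx *ᵥ (S.projVU S.Pgvu *ᵥ S.traceG w)) := by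
  rw [h w]
  have et (x : DGSpace S.mesh q) : S.edgeTrace x = S.edgeFun (S.traceG x) :=
    funext fun e => funext fun s => (edgeFun_traceG hn x e s).symm
  have eT (x : DGSpace S.mesh q) : S.edgeTraction x = S.edgeFun (S.Tv x) :=
    funext fun e => funext fun s => (edgeFun_Tv hn x e s).symm
  have es (f g : S.GVec) : (fun e s => S.edgeFun f e s - S.edgeFun g e s) = S.edgeFun (f - g) :=
    funext fun e => funext fun s => (edgeFun_sub f g e s).symm
  simp only [et, eT, es, ← dotProduct_MG_mulVec, sub_dotProduct, ← hbg.dotProduct]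

theorem kinetic_hasDerivWithinAt (hx : IsCompatible S.Hx S.Dx S.Dxx S.Sx S.Rx)
    (hy : IsFullyCompatible S.Hy S.Dy S.Dyy S.Ry) {ut : ℝ → S.Grid} {vt : ℝ → DGSpace S.mesh q}
    {a : S.Grid} {b : DGSpace S.mesh q} {s : Set ℝ} {t : ℝ} (hu : HasDerivWithinAt ut a s t)
    (hv : HasDerivWithinAt vt b s t) :
    HasDerivWithinAt (fun r => S.kinetic (ut r) (vt r))
      (2 * (S.rhou * (ut t ⬝ᵥ S.H *ᵥ a)) + 2 * (S.rhov * S.innerV b (vt t))) s t := by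
  have hH : S.Hᵀ = S.H := by
    rw [H_eq, tensor_transpose, posSemidef_transpose_eq hx.isSBP.posDef.posSemidef,
      posSemidef_transpose_eq hy.isSBP.posDef.posSemidef, Matrix.transpose_one]
  refine ((((isBilinearMap_dotProduct_mulVec S.H).hasDerivWithinAt hu hu).const_mul S.rhou).add
    ((isBilinearMap_innerV.hasDerivWithinAt hv hv).const_mul S.rhov)).congr_deriv ?_
  rw [dotProduct_mulVec_comm_of_transpose_eq hH a, show S.innerV (vt t) b = S.innerV b (vt t) by
    simp only [innerV, mul_comm]]
  ring

/-- By symmetry of the forms the derivative is brought to the pairings of the tested equations, up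
to bilinearity, so that conservation becomes a ring identity. -/
theorem U1_hasDerivWithinAt {u : ℝ → S.Grid} {v : ℝ → DGSpace S.mesh q}
    {d : S.Grid} {w : DGSpace S.mesh q} {s : Set ℝ} {t : ℝ} (hu : HasDerivWithinAt u d s t)
    (hv : HasDerivWithinAt v w s t) :
    HasDerivWithinAt (fun r => S.U1 (u r) (v r))
      (2 * (2 * S.muv * S.innerStrain (v t) w + S.lav * S.innerDiv (v t) w
          - S.interiorFlux (v t) w)
        + S.chi1 * S.alphav / S.hv * (2 * (S.traceG (v t) ⬝ᵥ S.MG *ᵥ S.traceG w)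
          + 2 * ((S.projUV S.Pguv *ᵥ (S.BG *ᵥ d)) ⬝ᵥ S.MG *ᵥ (S.projUV S.Pguv *ᵥ (S.BG *ᵥ u t)))
          - 2 * ((S.projUV S.Pguv *ᵥ (S.BG *ᵥ d)) ⬝ᵥ S.MG *ᵥ S.traceG (v t)
            + (S.projUV S.Pguv *ᵥ (S.BG *ᵥ u t)) ⬝ᵥ S.MG *ᵥ S.traceG w))
        - (S.traceG (v t) ⬝ᵥ S.MG *ᵥ S.Tv w + S.Tv (v t) ⬝ᵥ S.MG *ᵥ S.traceG w)
        + ((S.projUV S.Pguv *ᵥ (S.BG *ᵥ u t)) ⬝ᵥ S.MG *ᵥ S.Tv w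
          + (S.projUV S.Pguv *ᵥ (S.BG *ᵥ d)) ⬝ᵥ S.MG *ᵥ S.Tv (v t))) s t := by
  have ha := isLinearMap_traceG.hasDerivWithinAt hv
  have hτ := isLinearMap_Tv.hasDerivWithinAt hv
  have hg := (isLinearMap_mulVec (S.projUV S.Pguv)).hasDerivWithinAt
    ((isLinearMap_mulVec S.BG).hasDerivWithinAt hu)
  have hM := isBilinearMap_dotProduct_mulVec S.MG
  have c (f g : S.GVec) := dotProduct_mulVec_comm_of_transpose_eq (MG_transpose (S := S)) f g
  refine (((((((isBilinearMap_innerStrain.hasDerivWithinAt hv hv).const_mul (2 * S.muv)).add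
    ((isBilinearMap_innerDiv.hasDerivWithinAt hv hv).const_mul S.lav)).sub
    (isBilinearMap_interiorFlux.hasDerivWithinAt hv hv)).add
    ((((hM.hasDerivWithinAt ha ha).add (hM.hasDerivWithinAt hg hg)).sub
      ((hM.hasDerivWithinAt hg ha).const_mul 2)).const_mul (S.chi1 * S.alphav / S.hv))).sub
    (hM.hasDerivWithinAt ha hτ)).add (hM.hasDerivWithinAt hg hτ)).congr_deriv ?_
  rw [interiorFlux_comm w, show S.innerDiv w (v t) = S.innerDiv (v t) w by
    simp only [innerDiv, mul_comm], show S.innerStrain w (v t) = S.innerStrain (v t) w by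
    simp only [innerStrain, contract_comm], c (S.traceG w) (S.traceG (v t)),
    c (S.traceG w) (S.Tv (v t)), c (S.projUV S.Pguv *ᵥ (S.BG *ᵥ u t))
      (S.projUV S.Pguv *ᵥ (S.BG *ᵥ d))]
  ring

theorem U2_hasDerivWithinAt (hx : IsCompatible S.Hx S.Dx S.Dxx S.Sx S.Rx)
    (hy : IsFullyCompatible S.Hy S.Dy S.Dyy S.Ry) {u : ℝ → S.Grid} {v : ℝ → DGSpace S.mesh q}
    {d : S.Grid} {w : DGSpace S.mesh q} {s : Set ℝ} {t : ℝ} (hu : HasDerivWithinAt u d s t)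
    (hv : HasDerivWithinAt v w s t) :
    HasDerivWithinAt (fun r => S.U2 (u r) (v r))
      (2 * (d ⬝ᵥ S.Umat *ᵥ u t)
        + S.chi2 * S.betau / S.hu * (2 * ((S.BG *ᵥ d) ⬝ᵥ S.alongX S.Hx *ᵥ (S.BG *ᵥ u t))
          + 2 * ((S.projVU S.Pgvu *ᵥ S.traceG (v t)) ⬝ᵥ
              S.alongX S.Hx *ᵥ (S.projVU S.Pgvu *ᵥ S.traceG w))
          - 2 * ((S.BG *ᵥ u t) ⬝ᵥ S.alongX S.Hx *ᵥ (S.projVU S.Pgvu *ᵥ S.traceG w)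
            + (S.BG *ᵥ d) ⬝ᵥ S.alongX S.Hx *ᵥ (S.projVU S.Pgvu *ᵥ S.traceG (v t))))
        - ((S.Tu *ᵥ d) ⬝ᵥ S.alongX S.Hx *ᵥ (S.BG *ᵥ u t)
          + (S.BG *ᵥ d) ⬝ᵥ S.alongX S.Hx *ᵥ (S.Tu *ᵥ u t))
        + ((S.Tu *ᵥ u t) ⬝ᵥ S.alongX S.Hx *ᵥ (S.projVU S.Pgvu *ᵥ S.traceG w)
          + (S.Tu *ᵥ d) ⬝ᵥ S.alongX S.Hx *ᵥ (S.projVU S.Pgvu *ᵥ S.traceG (v t)))) s t := by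
  have hX : (S.alongX S.Hx)ᵀ = S.alongX S.Hx := by
    rw [alongX_eq, tensor_transpose, posSemidef_transpose_eq hx.isSBP.posDef.posSemidef,
      Matrix.transpose_one, Matrix.transpose_one]
  have hp := (isLinearMap_mulVec (S.projVU S.Pgvu)).hasDerivWithinAt
    (isLinearMap_traceG.hasDerivWithinAt hv)
  have hG := (isLinearMap_mulVec S.BG).hasDerivWithinAt hu
  have hT := (isLinearMap_mulVec S.Tu).hasDerivWithinAt hu
  have hM := isBilinearMap_dotProduct_mulVec (S.alongX S.Hx)
  have c (f g : S.Grid) := dotProduct_mulVec_comm_of_transpose_eq hX f g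
  refine ((((((isBilinearMap_dotProduct_mulVec S.Umat).hasDerivWithinAt hu hu).add
    ((((hM.hasDerivWithinAt hG hG).add (hM.hasDerivWithinAt hp hp)).sub
      ((hM.hasDerivWithinAt hG hp).const_mul 2)).const_mul (S.chi2 * S.betau / S.hu))).sub
    (hM.hasDerivWithinAt hG hT)).add (hM.hasDerivWithinAt hT hp))).congr_deriv ?_
  rw [dotProduct_mulVec_comm_of_transpose_eq (Umat_transpose hx hy) (u t) d,
    c (S.BG *ᵥ u t) (S.BG *ᵥ d), c (S.projVU S.Pgvu *ᵥ S.traceG w)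
      (S.projVU S.Pgvu *ᵥ S.traceG (v t)), c (S.BG *ᵥ u t) (S.Tu *ᵥ d)]
  ring

/-- Needed at time 0, where the equations are not imposed and only continuity of the state is known.
-/
theorem continuous_energy : Continuous fun x : (S.Grid × S.Grid) × DGSpace S.mesh q ×
    DGSpace S.mesh q => S.kinetic x.1.2 x.2.2 + S.U1 x.1.1 x.2.1 + S.U2 x.1.1 x.2.1 := by
  have h5 := (isLinearMap_traceG (S := S)).continuous
  have h6 := (isLinearMap_Tv (S := S)).continuous
  have k1 := (isBilinearMap_innerV (S := S)).continuous_diag.comp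
    ((continuous_snd (X := DGSpace S.mesh q) (Y := DGSpace S.mesh q)).comp
      (continuous_snd (X := S.Grid × S.Grid)))
  have hv := (continuous_fst (X := DGSpace S.mesh q) (Y := DGSpace S.mesh q)).comp
      (continuous_snd (X := S.Grid × S.Grid))
  have k2 := (isBilinearMap_innerStrain (S := S)).continuous_diag.comp hv
  have k3 := (isBilinearMap_innerDiv (S := S)).continuous_diag.comp hv
  have k4 := (isBilinearMap_interiorFlux (S := S)).continuous_diag.comp hv
  simp only [Function.comp_def] at k1 k2 k3 k4
  unfold kinetic U1 U2
  fun_prop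

theorem energy_conserved (hn : Function.Injective S.nodes)
    (hx : IsCompatible S.Hx S.Dx S.Dxx S.Sx S.Rx) (hy : IsFullyCompatible S.Hy S.Dy S.Dyy S.Ry)
    (hgb : S.NormCompatible S.Pguv S.Pbvu) (hbg : S.NormCompatible S.Pbuv S.Pgvu)
    (hα : S.alphau = S.alphav) (hβ : S.betau = S.betav) {T : ℝ} {u ut utt : ℝ → S.Grid}
    {v vt vtt : ℝ → DGSpace S.mesh q} (h : S.IsSolution T u ut utt v vt vtt) {t : ℝ}
    (ht : t ∈ Set.Icc 0 T) :
    S.kinetic (ut t) (vt t) + S.U1 (u t) (v t) + S.U2 (u t) (v t)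
      = S.kinetic (ut 0) (vt 0) + S.U1 (u 0) (v 0) + S.U2 (u 0) (v 0) := by
  rcases ht.1.eq_or_lt with rfl | ht0
  · rfl
  set f : ℝ → ℝ := fun r => S.kinetic (ut r) (vt r) + S.U1 (u r) (v r) + S.U2 (u r) (v r) with hf
  have hcont : ContinuousOn f (Set.Icc 0 t) := by
    have h1 : ContinuousOn (fun r => ((u r, ut r), (v r, vt r))) (Set.Icc 0 T) :=
      (h.cont_u.prodMk h.cont_ut).prodMk (h.cont_v.prodMk h.cont_vt)
    exact (continuous_energy.comp_continuousOn h1).mono (Set.Icc_subset_Icc_right ht.2)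
  have hder : ∀ r ∈ Set.Ioo 0 t, HasDerivAt f 0 r := by
    intro r hr
    have hr' : r ∈ Set.Ioc 0 T := ⟨hr.1, (hr.2.trans_le ht.2).le⟩
    have hfd := FDEquation.test hx hy hgb (h.fd r hr') (ut r)
    have hdg := DGEquation.test hn hbg (h.dg r hr') (vt r)
    have hd := ((kinetic_hasDerivWithinAt hx hy (h.deriv_ut r hr') (h.deriv_vt r hr')).add
      (U1_hasDerivWithinAt (h.deriv_u r hr') (h.deriv_v r hr'))).add
      (U2_hasDerivWithinAt hx hy (h.deriv_u r hr') (h.deriv_v r hr'))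
    -- As 0 < r < t ≤ T, the one-sided notion is a genuine derivative at r. What is left is the
    -- cancellation itself, which needs equal penalty parameters on the two sides.
    refine (hd.congr_deriv ?_).hasDerivAt (Icc_mem_nhds hr.1 (hr.2.trans_le ht.2))
    rw [hfd, hdg, hα, hβ]
    simp only [Matrix.mulVec_sub, dotProduct_sub, sub_dotProduct]
    ring
  obtain ⟨c, -, hc⟩ := exists_hasDerivAt_eq_slope f (fun _ => 0) ht0 hcont hder
  have h0 : f t - f 0 = 0 := by
    rw [eq_comm, div_eq_zero_iff] at hc
    exact hc.resolve_right (by linarith)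
  exact sub_eq_zero.1 h0

/-- An infimum over an empty family of reals is 0, so a triangle must exist; Γ is nonempty and
covered by edges, which provides one. -/
theorem ValidGeometry.hv_pos (hG : S.ValidGeometry) : 0 < S.hv := by
  have h : (S.a, S.y₀) ∈ Set.Icc S.a S.b ×ˢ ({S.y₀} : Set ℝ) :=
    ⟨⟨le_rfl, hG.ab.le⟩, rfl⟩
  rw [← hG.meshed] at h
  obtain ⟨e, -⟩ := Set.mem_iUnion.1 h
  have : Nonempty (Fin S.mesh.card) := ⟨e.1.1⟩
  exact TriMesh.hmin_pos

end CoupledScheme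

end ElasticFDDG

end

/-! ### Choice of the constant and conclusion -/

theorem mainTheorem1 (q : ℕ) (κ : ℝ) :
    ∃ C : ℝ, 0 < C ∧ ∀ S : ElasticFDDG.CoupledScheme q,
      S.ValidGeometry →
      S.mesh.ShapeRegular κ →
      Function.Injective S.nodes →
      0 ≤ S.rhou → 0 ≤ S.rhov →
      0 < S.muu → 0 < S.lau → 0 < S.muv → 0 < S.lav →
      ElasticFDDG.IsCompatible S.Hx S.Dx S.Dxx S.Sx S.Rx →
      ElasticFDDG.IsFullyCompatible S.Hy S.Dy S.Dyy S.Ry →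
      S.NormCompatible S.Pguv S.Pbvu →
      S.NormCompatible S.Pbuv S.Pgvu →
      S.alphau = S.alphav → 1 / (4 * C) ≤ S.alphav →
      1 / (4 * C) ≤ S.alphaI →
      S.betau = S.betav → 1 / (4 * ElasticFDDG.sbpBoundaryConst S.Hy S.hu) ≤ S.betav →
      (∀ (u : S.Grid) (v : ElasticFDDG.DGSpace S.mesh q), 0 ≤ S.U1 u v ∧ 0 ≤ S.U2 u v) ∧
      ∀ (T : ℝ) (u ut utt : ℝ → S.Grid) (v vt vtt : ℝ → ElasticFDDG.DGSpace S.mesh q),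
        S.IsSolution T u ut utt v vt vtt →
        ∀ t ∈ Set.Icc 0 T,
          S.kinetic (ut t) (vt t) + S.U1 (u t) (v t) + S.U2 (u t) (v t)
            = S.kinetic (ut 0) (vt 0) + S.U1 (u 0) (v 0) + S.U2 (u 0) (v 0) := by
  obtain ⟨c, hc, hc'⟩ := ElasticFDDG.exists_sq_eval_one_le q
  -- C must be positive for every real κ, including κ ≤ 0. Enlarging κ only weakens the mesh
  -- condition, because inradii are positive.
  have hκ : 0 < max κ 1 := lt_max_of_lt_right one_pos
  refine ⟨1 / (30 * c * max κ 1), by positivity, ?_⟩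
  intro S hG hM hn _ _ hmu hla hmv hlv hx hy hgb hbg hα hαv hαI hβ hβv
  have hM' : S.mesh.ShapeRegular (max κ 1) := fun K => (hM K).trans
    (mul_le_mul_of_nonneg_right (le_max_left _ _) (ElasticFDDG.TriMesh.inradius_pos K).le)
  refine ⟨fun u v => ⟨?_, ?_⟩, fun T u ut utt v vt vtt h t ht => ?_⟩
  · exact ElasticFDDG.CoupledScheme.U1_nonneg hc hc' hκ hM' hG.hv_pos hn hmv hlv hαv hαI u v
  · exact ElasticFDDG.CoupledScheme.U2_nonneg hG hx hy hmu hla hβv hβ u v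
  · exact ElasticFDDG.CoupledScheme.energy_conserved hn hx hy hgb hbg hα hβ h ht
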